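/- Let $d\in\mathbb N$, let $\Theta\subset\mathbb R^d$ be compact, let $\theta^0$ belong to the interior $\Theta^\circ$ of $\Theta$, and let $f_\theta:\mathbb R\to\mathbb R$ ($\theta\in\Theta$) and $w:\mathbb R\to\mathbb R$ be Borel functions. Consider the model $$Z_i=X_i+\varepsilon_i\quad(i\ge 0),\qquad X_i=f_{\theta^0}(X_{i-1})+\xi_i\quad(i\ge 1),$$ where $X_0$, $(\xi_i)_{i\ge1}$ and $(\varepsilon_i)_{i\ge0}$ are independent, the $\xi_i$ are i.i.d., centered and of finite variance, the $\varepsilon_i$ are i.i.d., centered, of finite variance and with a density $f_\varepsilon$, the chain $(X_i)_{i\ge0}$ is strictly stationary and ergodic, and $\mathbb E|X_0|<\infty$. Write $P_X$ for the law of $X_0$ and $\varphi^*(t)=\int e^{itx}\varphi(x)\,dx$ for $\varphi\in L^1(\mathbb R)$; $f^{(1)}_{\theta,i}=\partial f_\theta/\partial\theta_i$. Assume that $\Theta$ is contained in the closure of $\Theta^\circ$, and that there are $C,r>0$ such that any two points $\theta,\theta'\in\Theta^\circ$ with $\|\theta-\theta'\|\le r$ are joined by a path $\gamma:[0,1]\to\Theta^\circ$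 that is Lipschitz with constant $C\|\theta-\theta'\|$ (both hold, for instance, when $\Theta$ is convex). Assume moreover: 1. (Smoothness and moments) For every $x$, the map $\theta\mapsto f_\theta(x)$ is continuous on $\Theta$ and has continuous derivatives up to order 3 on $\Theta^\circ$. For every $\theta\in\Theta^\circ$, the quantity $w(X_0)(Z_1-f_\theta(X_0))^2$ and the absolute values of its partial derivatives in $\theta$ up to order 2 have finite expectation. 2. (Identifiability) The function $S(\theta)=\mathbb E[(f_{\theta^0}(X_0)-f_\theta(X_0))^2w(X_0)]$ on $\Theta$ has $\theta^0$ as its unique minimum point; its second partial derivatives exist on $\Theta^\circ$, and its Hessian matrix at $\theta^0$ equals $2\,\mathbb E[w(X_0)f^{(1)}_{\theta^0}(X_0)f^{(1)}_{\theta^0}(X_0)^\top]$ and is positive definite. 3. (Noise) $f_\varepsilon\in L^2(\mathbb R)$ and $f_\varepsilon^*(t)\ne0$ for all $t\in\mathbb R$. 4. (Weight, C11) For every $\theta\in\Theta$, the functions $w$, $wf_\theta$, $wf_\theta^2$ and $w^*/f_\varepsilon^*$, $(wf_\theta)^*/f_\varepsilon^*$, $(wf_\theta^2)^*/f_\varepsilon^*$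 belong to $L^1(\mathbb R)$. Moreover, either $P_X$ is absolutely continuous with respect to Lebesgue measure or, for every $\theta\in\Theta$, the functions $wf_\theta$ and $wf_\theta^2$ are continuous at $P_X$-almost every point. 5. (Weight, C11d1) For every $i\in\{1,\dots,d\}$, the functions $f^{(1)}_{\theta,i}w$ and $f_\theta f^{(1)}_{\theta,i}w$ belong to $L^1(\mathbb R)$ for all $\theta\in\Theta^\circ$, and $\sup_{\theta\in\Theta^\circ}|(f^{(1)}_{\theta,i}w)^*/f_\varepsilon^*|$ and $\sup_{\theta\in\Theta^\circ}|(f_\theta f^{(1)}_{\theta,i}w)^*/f_\varepsilon^*|$ belong to $L^1(\mathbb R)$. For $n\ge1$ let $$S_n(\theta)=\frac1{2\pi n}\sum_{k=1}^n\operatorname{Re}\int\frac{\big((Z_k-f_\theta)^2w\big)^*(t)\,e^{-itZ_{k-1}}}{f_\varepsilon^*(-t)}\,dt ,$$ and let $\hat\theta_n\in\Theta$ be (almost surely) a minimizer of $S_n$ over $\Theta$. Then $\hat\theta_n$ converges in probability to $\theta^0$ as $n\to\infty$. -/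

import Mathlib

open MeasureTheory ProbabilityTheory Filter Topology Set

noncomputable section

namespace ErrorsInVariablesAR

/-- The parameter space `ℝ^d` with its Euclidean norm. -/
abbrev Param (d : ℕ) := EuclideanSpace ℝ (Fin d)

/-- The Fourier transform `φ*(t) = ∫ e^{itx} φ(x) dx` of a function `φ : ℝ → ℝ`. It is used only for
functions that are integrable over `ℝ`. -/
def fourierStar (φ : ℝ → ℝ) (t : ℝ) : ℂ :=
  ∫ x : ℝ, Complex.exp (Complex.I * (t : ℂ) * (x : ℂ)) * (φ x : ℂ)

/-- The partial derivative `∂g/∂θ_i` of a real function of the parameter. -/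
def pderiv {d : ℕ} (i : Fin d) (g : Param d → ℝ) (θ : Param d) : ℝ :=
  lineDeriv ℝ g θ (EuclideanSpace.single i (1 : ℝ))

/-- The `i`-th partial derivative `f^{(1)}_{θ,i}(x)` of `θ ↦ f_θ(x)`. -/
def dRegr {d : ℕ} (f : Param d → ℝ → ℝ) (i : Fin d) (θ : Param d) (x : ℝ) : ℝ :=
  pderiv i (fun η => f η x) θ

/-- The autoregressive model with measurement error
`Z_i = X_i + ε_i` (`i ≥ 0`), `X_{i+1} = f_{θ⁰}(X_i) + ξ_{i+1}` (`i ≥ 0`).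
The innovations are indexed from `0`, so that `ξ i` stands for `ξ_{i+1}`. -/
structure IsModel {Ω : Type*} [MeasurableSpace Ω] (μ : Measure Ω) {d : ℕ}
    (f : Param d → ℝ → ℝ) (θ₀ : Param d) (fε : ℝ → ℝ) (X ξ ε Z : ℕ → Ω → ℝ) : Prop where
  measurable_X : ∀ i, Measurable (X i)
  measurable_ξ : ∀ i, Measurable (ξ i)
  measurable_ε : ∀ i, Measurable (ε i)
  observation : ∀ i, ∀ᵐ ω ∂μ, Z i ω = X i ω + ε i ω
  regression : ∀ i, ∀ᵐ ω ∂μ, X (i + 1) ω = f θ₀ (X i ω) + ξ i ω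
  /-- The innovations are i.i.d., centered, with finite variance. -/
  indep_ξ : iIndepFun ξ μ
  ident_ξ : ∀ i, IdentDistrib (ξ i) (ξ 0) μ μ
  memLp_ξ : MemLp (ξ 0) 2 μ
  mean_ξ : ∫ ω, ξ 0 ω ∂μ = 0
  /-- The errors are i.i.d., centered, with finite variance. -/
  indep_ε : iIndepFun ε μ
  ident_ε : ∀ i, IdentDistrib (ε i) (ε 0) μ μ
  memLp_ε : MemLp (ε 0) 2 μ
  mean_ε : ∫ ω, ε 0 ω ∂μ = 0
  /-- `fε` is the density of `ε_0` with respect to Lebesgue measure. -/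
  measurable_fε : Measurable fε
  fε_nonneg : ∀ x, 0 ≤ fε x
  density_ε : μ.map (ε 0) = volume.withDensity (fun x => ENNReal.ofReal (fε x))
  /-- `X_0`, the sequence `(ξ_i)` and the sequence `(ε_i)` are (mutually) independent. -/
  indep_X₀ : IndepFun (X 0) (fun ω => ((fun i => ξ i ω), (fun i => ε i ω))) μ
  indep_ξ_ε : IndepFun (fun ω i => ξ i ω) (fun ω i => ε i ω) μ
  /-- The chain `(X_i)` is strictly stationary and ergodic: its law on `ℝ^ℕ` is invariant under
  the shift, and the shift-invariant events have probability `0` or `1` under this law. -/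
  ergodic_X : Ergodic (fun (x : ℕ → ℝ) (i : ℕ) => x (i + 1)) (μ.map (fun ω i => X i ω))
  /-- `X_0` has a finite first moment. -/
  integrable_X₀ : Integrable (X 0) μ

/-- The standing assumptions on the parameter set `Θ`: it is compact, `θ⁰` is an interior point, `Θ`
lies in the closure of its interior `Θ°`, and any two points of `Θ°` close enough to each other are
joined inside `Θ°` by a path of length at most `C` times their distance (as when `Θ` is convex). -/
structure IsParamSet {d : ℕ} (Θ : Set (Param d)) (θ₀ : Param d) : Prop where
  isCompact : IsCompact Θ
  mem_interior : θ₀ ∈ interior Θ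
  subset_closure : Θ ⊆ closure (interior Θ)
  paths : ∃ C r : ℝ, 0 < r ∧ ∀ θ ∈ interior Θ, ∀ θ' ∈ interior Θ, dist θ θ' ≤ r →
    ∃ γ : ℝ → Param d, γ 0 = θ ∧ γ 1 = θ' ∧ (∀ s ∈ Icc (0 : ℝ) 1, γ s ∈ interior Θ) ∧
      ∀ s ∈ Icc (0 : ℝ) 1, ∀ t ∈ Icc (0 : ℝ) 1, dist (γ s) (γ t) ≤ C * dist θ θ' * |s - t|

/-- Smoothness of the regression functions: each `f_θ` is a Borel function, `θ ↦ f_θ(x)` is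
continuous on `Θ`, with continuous derivatives up to order 3 on the interior of `Θ`. -/
structure Smooth {d : ℕ} (Θ : Set (Param d)) (f : Param d → ℝ → ℝ) : Prop where
  measurable_f : ∀ θ ∈ Θ, Measurable (f θ)
  continuousOn : ∀ x, ContinuousOn (fun θ => f θ x) Θ
  contDiffOn : ∀ x, ContDiffOn ℝ 3 (fun θ => f θ x) (interior Θ)

/-- The random variable `w(X_0) (Z_1 - f_θ(X_0))²`. -/
def weightedResidual {Ω : Type*} {d : ℕ} (f : Param d → ℝ → ℝ) (w : ℝ → ℝ) (X Z : ℕ → Ω → ℝ)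
    (θ : Param d) (ω : Ω) : ℝ :=
  w (X 0 ω) * (Z 1 ω - f θ (X 0 ω)) ^ 2

/-- On the interior of `Θ`, the quantity `w(X_0) (Z_1 - f_θ(X_0))²` and the absolute values of its
derivatives in `θ` up to order 2 have a finite expectation. -/
structure MomentCondition {Ω : Type*} [MeasurableSpace Ω] (μ : Measure Ω) {d : ℕ}
    (Θ : Set (Param d)) (f : Param d → ℝ → ℝ) (w : ℝ → ℝ) (X Z : ℕ → Ω → ℝ) : Prop where
  order_zero : ∀ θ ∈ interior Θ, Integrable (weightedResidual f w X Z θ) μ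
  order_one : ∀ θ ∈ interior Θ, ∀ i : Fin d,
    Integrable (fun ω => pderiv i (fun η => weightedResidual f w X Z η ω) θ) μ
  order_two : ∀ θ ∈ interior Θ, ∀ i j : Fin d,
    Integrable (fun ω => pderiv i (pderiv j (fun η => weightedResidual f w X Z η ω)) θ) μ

/-- The contrast `S(θ) = E[(f_{θ⁰}(X) - f_θ(X))² w(X)]`, where `X` has the law of `X_0`. -/
def contrast {Ω : Type*} [MeasurableSpace Ω] (μ : Measure Ω) {d : ℕ}
    (f : Param d → ℝ → ℝ) (w : ℝ → ℝ) (X : ℕ → Ω → ℝ) (θ₀ θ : Param d) : ℝ :=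
  ∫ ω, (f θ₀ (X 0 ω) - f θ (X 0 ω)) ^ 2 * w (X 0 ω) ∂μ

/-- The matrix `E[w(X) f^{(1)}_{θ⁰}(X) f^{(1)}_{θ⁰}(X)ᵀ]`. -/
def gradMatrix {Ω : Type*} [MeasurableSpace Ω] (μ : Measure Ω) {d : ℕ}
    (f : Param d → ℝ → ℝ) (w : ℝ → ℝ) (X : ℕ → Ω → ℝ) (θ₀ : Param d) : Matrix (Fin d) (Fin d) ℝ :=
  Matrix.of fun i j => ∫ ω, w (X 0 ω) * dRegr f i θ₀ (X 0 ω) * dRegr f j θ₀ (X 0 ω) ∂μ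

/-- The identifiability assumptions: `θ⁰` is the unique minimum point of the contrast on `Θ`, the
contrast has second partial derivatives on the interior of `Θ`, and its Hessian matrix at `θ⁰` is
`2 E[w(X) f^{(1)}_{θ⁰}(X) f^{(1)}_{θ⁰}(X)ᵀ]` and is positive definite. -/
structure Identifiable {Ω : Type*} [MeasurableSpace Ω] (μ : Measure Ω) {d : ℕ}
    (Θ : Set (Param d)) (f : Param d → ℝ → ℝ) (w : ℝ → ℝ) (X : ℕ → Ω → ℝ) (θ₀ : Param d) :
    Prop where
  unique_min : ∀ θ ∈ Θ, θ ≠ θ₀ → contrast μ f w X θ₀ θ₀ < contrast μ f w X θ₀ θ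
  first_deriv : ∀ θ ∈ interior Θ, ∀ i : Fin d,
    LineDifferentiableAt ℝ (contrast μ f w X θ₀) θ (EuclideanSpace.single i (1 : ℝ))
  second_deriv : ∀ θ ∈ interior Θ, ∀ i j : Fin d,
    LineDifferentiableAt ℝ (pderiv j (contrast μ f w X θ₀)) θ (EuclideanSpace.single i (1 : ℝ))
  hessian_eq : (Matrix.of fun i j => pderiv i (pderiv j (contrast μ f w X θ₀)) θ₀) =
    (2 : ℝ) • gradMatrix μ f w X θ₀
  hessian_posDef : (Matrix.of fun i j => pderiv i (pderiv j (contrast μ f w X θ₀)) θ₀).PosDef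

/-- The error density is square integrable and its Fourier transform has no zero. -/
structure NoiseCondition (fε : ℝ → ℝ) : Prop where
  memLp : MemLp fε 2 (volume : Measure ℝ)
  fourier_ne_zero : ∀ t : ℝ, fourierStar fε t ≠ 0

/-- The condition on the weight function: for all `θ ∈ Θ`, the functions `w`, `w f_θ`, `w f_θ²` and
the functions `w*/fε*`, `(w f_θ)*/fε*`, `(w f_θ²)*/fε*` belong to `L¹(ℝ)`. Moreover, unless the law
`P_X` of `X_0` is absolutely continuous with respect to Lebesgue measure, `w f_θ` and `w f_θ²` are
continuous at `P_X`-almost every point. -/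
structure WeightCondition {Ω : Type*} [MeasurableSpace Ω] (μ : Measure Ω) {d : ℕ}
    (Θ : Set (Param d)) (f : Param d → ℝ → ℝ) (w : ℝ → ℝ) (fε : ℝ → ℝ) (X : ℕ → Ω → ℝ) :
    Prop where
  measurable_w : Measurable w
  integrable_w : Integrable w
  integrable_wf : ∀ θ ∈ Θ, Integrable (fun x => w x * f θ x)
  integrable_wf_sq : ∀ θ ∈ Θ, Integrable (fun x => w x * f θ x ^ 2)
  fourier_w : Integrable (fun t => fourierStar w t / fourierStar fε t)
  fourier_wf : ∀ θ ∈ Θ, Integrable (fun t =>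
    fourierStar (fun x => w x * f θ x) t / fourierStar fε t)
  fourier_wf_sq : ∀ θ ∈ Θ, Integrable (fun t =>
    fourierStar (fun x => w x * f θ x ^ 2) t / fourierStar fε t)
  continuity : μ.map (X 0) ≪ volume ∨ ∀ θ ∈ Θ, ∀ᵐ x ∂(μ.map (X 0)),
    ContinuousAt (fun y => w y * f θ y) x ∧ ContinuousAt (fun y => w y * f θ y ^ 2) x

/-- The condition on the first derivatives: for every `i`, the functions
`sup_θ |(f^{(1)}_{θ,i} w)*/fε*|` and `sup_θ |(f_θ f^{(1)}_{θ,i} w)*/fε*|` belong to `L¹(ℝ)`.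
The suprema run over the interior of `Θ`, where the derivatives exist. They are suprema of continuous
functions of `t`, hence measurable, and belong to `L¹(ℝ)` if and only if their integral is finite. -/
structure DerivWeightCondition {d : ℕ} (Θ : Set (Param d)) (f : Param d → ℝ → ℝ)
    (w : ℝ → ℝ) (fε : ℝ → ℝ) : Prop where
  integrable_df : ∀ θ ∈ interior Θ, ∀ i : Fin d, Integrable (fun x => dRegr f i θ x * w x)
  integrable_fdf : ∀ θ ∈ interior Θ, ∀ i : Fin d,
    Integrable (fun x => f θ x * dRegr f i θ x * w x)
  sup_df : ∀ i : Fin d, ∫⁻ t : ℝ, (⨆ θ ∈ interior Θ,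
    ‖fourierStar (fun x => dRegr f i θ x * w x) t / fourierStar fε t‖ₑ) < ⊤
  sup_fdf : ∀ i : Fin d, ∫⁻ t : ℝ, (⨆ θ ∈ interior Θ,
    ‖fourierStar (fun x => f θ x * dRegr f i θ x * w x) t / fourierStar fε t‖ₑ) < ⊤

/-- The least squares deconvolution criterion
`S_n(θ) = (1/(2πn)) ∑_{k=1}^n Re ∫ ((Z_k - f_θ)² w)*(t) e^{-itZ_{k-1}} / fε*(-t) dt`,
as a function of the sequence `z` of the observed values. -/
def criterion {d : ℕ} (f : Param d → ℝ → ℝ) (w : ℝ → ℝ) (fε : ℝ → ℝ) (n : ℕ) (z : ℕ → ℝ)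
    (θ : Param d) : ℝ :=
  1 / (2 * Real.pi * (n : ℝ)) * ∑ k ∈ Finset.Icc 1 n,
    (∫ t : ℝ, fourierStar (fun x => (z k - f θ x) ^ 2 * w x) t *
      Complex.exp (-(Complex.I * (t : ℂ) * (z (k - 1) : ℂ))) / fourierStar fε (-t)).re

end ErrorsInVariablesAR

end

namespace ErrorsInVariablesAR

open scoped FourierTransform ContDiff

/-! ### The Fourier transform `fourierStar` -/

section Fourier

variable {φ : ℝ → ℝ}

/-! The argument is the usual one for M-estimators: a law of large numbers, an identifiable limit,
and enough equicontinuity to pass from pointwise to uniform convergence.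

Expanding the square, `criterion_eq` writes $S_n(\theta)$ as a term free of $\theta$ plus the
empirical mean of `deconvLoss` at $(Z_{k-1},Z_k)$. The free term contains $Z_k^2$, which need not be
integrable because $X_0$ has only a first moment; it does not affect minimizers and is discarded.
What remains is affine in $Z_k$ with coefficients that are bounded functions of $Z_{k-1}$, hence
integrable.

Limit. Averaging a deconvolution kernel over the error cancels $f_\varepsilon^*$ and leaves the
inverse transform of $\varphi^*$ (`integral_deconv_add`), which equals $\varphi$ at $P_X$-almost
every point (`ae_fourierInvStar_eq`). With the centering of $\xi_1$ and $\varepsilon_1$, the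
expected loss $T$ satisfies $T(\theta)-T(\theta^0)=S(\theta)$ (`contrast_eq`), so $\theta^0$ is its
unique minimum point.

Law of large numbers. The chain is independent of the i.i.d. errors, so the pair is driven by the
product of an ergodic shift with a Bernoulli shift. That product is ergodic
(`ergodic_prodMap_shift`), and the mean ergodic theorem in $L^1$ gives convergence in probability.

Equicontinuity. By `exists_lipschitz_deconv`, $\theta\mapsto (wf_\theta)^*/f_\varepsilon^*$ and
$\theta\mapsto (wf_\theta^2)^*/f_\varepsilon^*$ are Lipschitz into $L^1$ at small distances. The
loss is then Lipschitz in $\theta$ with an integrable random constant, and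
`tendstoInMeasure_of_isMinOn` concludes by a finite cover. -/

lemma fourierStar_eq_fourier (φ : ℝ → ℝ) (t : ℝ) :
    fourierStar φ t = 𝓕 (fun x => (φ x : ℂ)) (-t / (2 * Real.pi)) := by
  rw [Real.fourier_real_eq_integral_exp_smul, fourierStar]
  refine integral_congr_ae (ae_of_all _ fun x => ?_)
  simp only [smul_eq_mul]
  congr 1
  push_cast
  have : (Real.pi : ℂ) ≠ 0 := by exact_mod_cast Real.pi_ne_zero
  field_simp

lemma fourier_eq_fourierStar (φ : ℝ → ℝ) (v : ℝ) :
    𝓕 (fun x => (φ x : ℂ)) v = fourierStar φ (-2 * Real.pi * v) := by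
  rw [fourierStar_eq_fourier]
  field_simp

lemma continuous_fourierStar (hφ : Integrable φ) : Continuous (fourierStar φ) := by
  have h : Continuous (𝓕 (fun x => (φ x : ℂ))) :=
    VectorFourier.fourierIntegral_continuous Real.continuous_fourierChar (by fun_prop) hφ.ofReal
  rw [show fourierStar φ = fun t => 𝓕 (fun x => (φ x : ℂ)) (-t / (2 * Real.pi)) from
    funext (fourierStar_eq_fourier φ)]
  fun_prop

lemma norm_exp_I_mul_mul (t x : ℝ) : ‖Complex.exp (Complex.I * (t : ℂ) * (x : ℂ))‖ = 1 := by
  rw [show Complex.I * (t : ℂ) * (x : ℂ) = ((t * x : ℝ) : ℂ) * Complex.I by push_cast; ring]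
  exact Complex.norm_exp_ofReal_mul_I _

lemma norm_exp_neg_I_mul_mul (t x : ℝ) :
    ‖Complex.exp (-(Complex.I * (t : ℂ) * (x : ℂ)))‖ = 1 := by
  rw [Complex.exp_neg, norm_inv, norm_exp_I_mul_mul, inv_one]

lemma integrable_exp_mul {φ : ℝ → ℝ} (hφ : Integrable φ) (t : ℝ) :
    Integrable (fun x : ℝ => Complex.exp (Complex.I * (t : ℂ) * (x : ℂ)) * (φ x : ℂ)) := by
  refine hφ.ofReal.bdd_mul (c := 1) (by fun_prop) (ae_of_all _ fun x => ?_)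
  rw [norm_exp_I_mul_mul]

lemma norm_fourierStar_le (φ : ℝ → ℝ) (t : ℝ) : ‖fourierStar φ t‖ ≤ ∫ x, |φ x| := by
  refine (norm_integral_le_integral_norm _).trans_eq ?_
  simp [norm_exp_I_mul_mul]

lemma fourierStar_neg (φ : ℝ → ℝ) (t : ℝ) :
    fourierStar φ (-t) = starRingEnd ℂ (fourierStar φ t) := by
  rw [fourierStar, fourierStar, ← integral_conj]
  congr 1 with x
  rw [map_mul, ← Complex.exp_conj]
  simp

lemma norm_fourierStar_neg (φ : ℝ → ℝ) (t : ℝ) : ‖fourierStar φ (-t)‖ = ‖fourierStar φ t‖ := by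
  rw [fourierStar_neg, RCLike.norm_conj]

lemma fourierStar_add {φ ψ : ℝ → ℝ} (hφ : Integrable φ) (hψ : Integrable ψ) (t : ℝ) :
    fourierStar (fun x => φ x + ψ x) t = fourierStar φ t + fourierStar ψ t := by
  rw [fourierStar, fourierStar, fourierStar,
    ← integral_add (integrable_exp_mul hφ t) (integrable_exp_mul hψ t)]
  congr 1 with x
  push_cast
  ring

lemma fourierStar_const_mul (c : ℝ) (φ : ℝ → ℝ) (t : ℝ) :
    fourierStar (fun x => c * φ x) t = c * fourierStar φ t := by
  rw [fourierStar, fourierStar, ← integral_const_mul]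
  congr 1 with x
  push_cast
  ring

lemma fourierStar_sub {φ ψ : ℝ → ℝ} (hφ : Integrable φ) (hψ : Integrable ψ) (t : ℝ) :
    fourierStar (fun x => φ x - ψ x) t = fourierStar φ t - fourierStar ψ t := by
  rw [fourierStar, fourierStar, fourierStar,
    ← integral_sub (integrable_exp_mul hφ t) (integrable_exp_mul hψ t)]
  congr 1 with x
  push_cast
  ring

/-- The multiplication formula for the Fourier transform. -/
lemma integral_mul_fourierStar {φ ψ : ℝ → ℝ} (hφ : Integrable φ) (hψ : Integrable ψ) :
    ∫ t, (ψ t : ℂ) * fourierStar φ t = ∫ x, fourierStar ψ x * (φ x : ℂ) := by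
  have key : Integrable (Function.uncurry fun t x : ℝ =>
      (ψ t : ℂ) * (Complex.exp (Complex.I * (t : ℂ) * (x : ℂ)) * (φ x : ℂ)))
      (volume.prod volume) := by
    have h := (hψ.ofReal (𝕜 := ℂ)).mul_prod (hφ.ofReal (𝕜 := ℂ))
    refine (h.bdd_mul (c := 1)
      (f := fun p : ℝ × ℝ => Complex.exp (Complex.I * (p.1 : ℂ) * (p.2 : ℂ)))
      (by fun_prop) (ae_of_all _ fun p => ?_)).congr (ae_of_all _ fun p => ?_)
    · rw [norm_exp_I_mul_mul]
    · change _ * ((ψ p.1 : ℂ) * (φ p.2 : ℂ)) = (ψ p.1 : ℂ) * (_ * (φ p.2 : ℂ))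
      ring
  simp only [fourierStar, ← integral_const_mul, ← integral_mul_const]
  rw [integral_integral_swap key]
  congr 1 with x
  congr 1 with t
  rw [mul_right_comm Complex.I]
  ring

/-- The inverse transform of `φ*`, as an integral. -/
noncomputable def fourierInvStar (G : ℝ → ℂ) (x : ℝ) : ℂ :=
  (1 / (2 * Real.pi) : ℝ) * ∫ t : ℝ, G t * Complex.exp (-(Complex.I * (t : ℂ) * (x : ℂ)))

lemma fourierInvStar_fourierStar (φ : ℝ → ℝ) (x : ℝ) :
    fourierInvStar (fourierStar φ) x = 𝓕⁻ (𝓕 (fun x => (φ x : ℂ))) x := by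
  rw [Real.fourierInv_eq', fourierInvStar]
  have h := Measure.integral_comp_mul_left (fun t : ℝ => fourierStar φ t *
    Complex.exp (-(Complex.I * (t : ℂ) * (x : ℂ)))) (-2 * Real.pi)
  have h1 : |(-2 * Real.pi)⁻¹| = 1 / (2 * Real.pi) := by
    rw [abs_inv, abs_mul, abs_of_pos Real.pi_pos]
    norm_num
  rw [h1, Complex.real_smul] at h
  rw [← h]
  congr 1 with v
  rw [fourier_eq_fourierStar, smul_eq_mul, mul_comm]
  congr 2
  simp
  ring

lemma integrable_fourier_of_integrable_fourierStar (h : Integrable (fourierStar φ)) :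
    Integrable (𝓕 (fun x => (φ x : ℂ))) := by
  have := h.comp_mul_left' (R := -2 * Real.pi) (by simp [Real.pi_ne_zero])
  exact this.congr (ae_of_all _ fun v => (fourier_eq_fourierStar φ v).symm)

lemma fourierInvStar_fourierStar_of_continuousAt (hφ : Integrable φ)
    (h : Integrable (fourierStar φ)) {x : ℝ} (hx : ContinuousAt φ x) :
    fourierInvStar (fourierStar φ) x = φ x := by
  rw [fourierInvStar_fourierStar]
  exact hφ.ofReal.fourierInv_fourier_eq (integrable_fourier_of_integrable_fourierStar h)
    (Complex.continuous_ofReal.continuousAt.comp hx)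

lemma integrable_fourier_of_contDiff {g : ℝ → ℂ} (hg : ContDiff ℝ ∞ g)
    (hc : HasCompactSupport g) : Integrable (𝓕 g) :=
  (𝓕 (hc.toSchwartzMap hg)).integrable (μ := volume)

lemma integrable_fourierStar_of_contDiff {ψ : ℝ → ℝ} (hψ : ContDiff ℝ ∞ ψ)
    (hc : HasCompactSupport ψ) : Integrable (fourierStar ψ) := by
  have h1 : ContDiff ℝ ∞ (fun x => (ψ x : ℂ)) := Complex.ofRealCLM.contDiff.comp hψ
  have h2 : HasCompactSupport (fun x => (ψ x : ℂ)) := hc.comp_left (g := fun x : ℝ => (x : ℂ)) rfl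
  have h3 := (integrable_fourier_of_contDiff h1 h2).comp_mul_left'
    (R := -1 / (2 * Real.pi)) (by simp [Real.pi_ne_zero])
  refine h3.congr (ae_of_all _ fun t => ?_)
  have h4 : -1 / (2 * Real.pi) * t = -t / (2 * Real.pi) := by ring
  rw [fourierStar_eq_fourier, ← h4]

lemma integral_fourier_mul_eq {f g : ℝ → ℂ} (hf : Integrable f) (hg : Integrable g) :
    ∫ x, 𝓕 f x * g x = ∫ x, f x * 𝓕 g x := by
  have h := VectorFourier.integral_fourierIntegral_smul_eq_flip (L := innerₗ ℝ)
    (e := Real.fourierChar) Real.continuous_fourierChar (by fun_prop) hf hg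
  rw [flip_innerₗ] at h
  exact h

lemma continuous_fourier {f : ℝ → ℂ} (hf : Integrable f) : Continuous (𝓕 f) :=
  VectorFourier.fourierIntegral_continuous Real.continuous_fourierChar (by fun_prop) hf

/-- Duality: tested against a smooth compactly supported $\psi$, both transforms move onto $\psi$ by
the multiplication formula, and inversion holds for $\psi$. This needs no continuity of $\varphi$.
-/
lemma fourierInvStar_fourierStar_ae (hφ : Integrable φ) (h : Integrable (fourierStar φ)) :
    ∀ᵐ x, fourierInvStar (fourierStar φ) x = φ x := by
  have hφc : Integrable (fun x => (φ x : ℂ)) := hφ.ofReal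
  have hF := integrable_fourier_of_integrable_fourierStar h
  have hcont : Continuous (𝓕⁻ (𝓕 (fun x => (φ x : ℂ)))) := by
    rw [Real.fourierInv_eq_fourier_comp_neg]
    exact continuous_fourier hF.comp_neg
  simp only [fourierInvStar_fourierStar]
  refine ae_eq_of_integral_contDiff_smul_eq hcont.locallyIntegrable
    hφ.ofReal.locallyIntegrable fun ψ hψ hc => ?_
  have h1 : ContDiff ℝ ∞ (fun x => (ψ x : ℂ)) := Complex.ofRealCLM.contDiff.comp hψ
  have h2 : HasCompactSupport (fun x => (ψ x : ℂ)) := hc.comp_left (g := fun x : ℝ => (x : ℂ)) rfl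
  have hψi : Integrable (fun x => (ψ x : ℂ)) := h1.continuous.integrable_of_hasCompactSupport h2
  have h3 : Integrable (𝓕⁻ (fun x => (ψ x : ℂ))) := by
    have := (𝓕⁻ (h2.toSchwartzMap h1)).integrable (μ := volume)
    rwa [SchwartzMap.fourierInv_coe] at this
  have h4 : 𝓕 (𝓕⁻ (fun x => (ψ x : ℂ))) = fun x => (ψ x : ℂ) :=
    h1.continuous.fourier_fourierInv_eq hψi
      (integrable_fourier_of_contDiff h1 h2)
  simp only [Complex.real_smul]
  calc ∫ x, (ψ x : ℂ) * 𝓕⁻ (𝓕 (fun x => (φ x : ℂ))) x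
      = ∫ x, 𝓕 (fun y => 𝓕 (fun x => (φ x : ℂ)) (-y)) x * (ψ x : ℂ) := by
        rw [Real.fourierInv_eq_fourier_comp_neg]
        simp only [mul_comm]
    _ = ∫ x, 𝓕 (fun x => (φ x : ℂ)) (-x) * 𝓕 (fun x => (ψ x : ℂ)) x :=
        integral_fourier_mul_eq hF.comp_neg hψi
    _ = ∫ x, 𝓕 (fun x => (φ x : ℂ)) x * 𝓕⁻ (fun x => (ψ x : ℂ)) x := by
        rw [← integral_neg_eq_self]
        simp only [neg_neg, Real.fourierInv_eq_fourier_neg]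
    _ = ∫ x, (φ x : ℂ) * (ψ x : ℂ) := by
        rw [integral_fourier_mul_eq hφc h3, h4]
    _ = ∫ x, (ψ x : ℂ) * (φ x : ℂ) := by simp only [mul_comm]

lemma norm_fourierInvStar_le (G : ℝ → ℂ) (x : ℝ) :
    ‖fourierInvStar G x‖ ≤ 1 / (2 * Real.pi) * ∫ t, ‖G t‖ := by
  rw [fourierInvStar, norm_mul]
  have h0 : 0 ≤ 1 / (2 * Real.pi) := by positivity
  rw [Complex.norm_real, Real.norm_of_nonneg h0]
  gcongr
  refine (norm_integral_le_integral_norm _).trans_eq ?_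
  simp [norm_exp_neg_I_mul_mul]

/-- Turns an $L^1$ bound in frequency into a sup bound in space; the bounds on the derivatives
$f^{(1)}_{\theta,i}w$ come from here. -/
lemma abs_le_integral_norm_fourierStar_ae (hφ : Integrable φ) (h : Integrable (fourierStar φ)) :
    ∀ᵐ x, |φ x| ≤ 1 / (2 * Real.pi) * ∫ t, ‖fourierStar φ t‖ := by
  filter_upwards [fourierInvStar_fourierStar_ae hφ h] with x hx
  rw [← Real.norm_eq_abs, ← Complex.norm_real, ← hx]
  exact norm_fourierInvStar_le _ _

end Fourier

end ErrorsInVariablesAR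
namespace ErrorsInVariablesAR

open scoped FourierTransform ContDiff

/-! ### Lipschitz estimates on the parameter set -/

section Paths

variable {d : ℕ} {Θ : Set (Param d)} {C r : ℝ}

/-- Points of the interior of `Θ` at distance at most `r` are joined inside the interior by a
path that is Lipschitz with constant `C` times their distance. -/
def JoinedByPaths (Θ : Set (Param d)) (C r : ℝ) : Prop :=
  ∀ θ ∈ interior Θ, ∀ θ' ∈ interior Θ, dist θ θ' ≤ r →
    ∃ γ : ℝ → Param d, γ 0 = θ ∧ γ 1 = θ' ∧ (∀ s ∈ Icc (0 : ℝ) 1, γ s ∈ interior Θ) ∧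
      ∀ s ∈ Icc (0 : ℝ) 1, ∀ t ∈ Icc (0 : ℝ) 1, dist (γ s) (γ t) ≤ C * dist θ θ' * |s - t|

lemma IsParamSet.joinedByPaths {θ₀ : Param d} (h : IsParamSet Θ θ₀) :
    ∃ C r : ℝ, 0 ≤ C ∧ 0 < r ∧ JoinedByPaths Θ C r := by
  obtain ⟨C, r, hr, hp⟩ := h.paths
  -- `paths` does not fix the sign of `C`; enlarging it to `|C|` makes later products monotone.
  refine ⟨|C|, r, abs_nonneg _, hr, fun θ hθ θ' hθ' hd => ?_⟩
  obtain ⟨γ, h0, h1, hi, hl⟩ := hp θ hθ θ' hθ' hd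
  refine ⟨γ, h0, h1, hi, fun s hs t ht => (hl s hs t ht).trans ?_⟩
  gcongr
  exact le_abs_self C

/-- A function that is locally `L`-Lipschitz in the interior of `Θ`. -/
def LocallyLipschitzInside {E : Type*} [NormedAddCommGroup E] (Θ : Set (Param d))
    (F : Param d → E) (L : ℝ) : Prop :=
  ∀ a ∈ interior Θ, ∃ δ > 0, ∀ x ∈ Metric.ball a δ, ∀ y ∈ Metric.ball a δ,
    ‖F x - F y‖ ≤ L * dist x y

variable {E : Type*} [NormedAddCommGroup E] {F : Param d → E} {L : ℝ}

/-- The interior need not be convex, so the local estimates are chained along the path: by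
compactness of $[0,1]$ it splits into finitely many pieces, each inside one ball where the local
bound holds, and the increments telescope to $L$ times the Lipschitz constant of the path. -/
lemma LocallyLipschitzInside.norm_sub_le (hF : LocallyLipschitzInside Θ F L) (hL : 0 ≤ L)
    (hΘ : JoinedByPaths Θ C r) {θ θ' : Param d} (hθ : θ ∈ interior Θ) (hθ' : θ' ∈ interior Θ)
    (hd : dist θ θ' ≤ r) : ‖F θ - F θ'‖ ≤ L * C * dist θ θ' := by
  obtain ⟨γ, h0, h1, hi, hl⟩ := hΘ θ hθ θ' hθ' hd
  choose! δ hδ hFδ using hF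
  have hγ : Continuous fun s : unitInterval => γ s := by
    refine (LipschitzWith.of_dist_le_mul (K := (C * dist θ θ').toNNReal) fun s t => ?_).continuous
    refine (hl s s.2 t t.2).trans ?_
    gcongr
    · exact Real.le_coe_toNNReal _
    · exact (Real.dist_eq _ _).ge
  obtain ⟨t, ht0, htm, ⟨N, hN⟩, ht⟩ := exists_monotone_Icc_subset_open_cover_unitInterval
    (ι := unitInterval) (c := fun u => (fun s : unitInterval => γ s) ⁻¹' Metric.ball (γ u) (δ (γ u)))
    (fun u => Metric.isOpen_ball.preimage hγ)
    (fun u _ => mem_iUnion.2 ⟨u, Metric.mem_ball_self (hδ _ (hi u u.2))⟩)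
  have key : ∀ n, ‖F (γ (t n)) - F (γ 0)‖ ≤ L * (C * dist θ θ') * (t n : ℝ) := by
    intro n
    induction n with
    | zero => simp [ht0]
    | succ n ih =>
      obtain ⟨u, hu⟩ := ht n
      have ha : γ (t n) ∈ Metric.ball (γ u) (δ (γ u)) := hu ⟨le_rfl, htm n.le_succ⟩
      have hb : γ (t (n + 1)) ∈ Metric.ball (γ u) (δ (γ u)) := hu ⟨htm n.le_succ, le_rfl⟩
      have hab := hFδ (γ u) (hi u u.2) _ hb _ ha
      have hle : (t n : ℝ) ≤ t (n + 1) := htm n.le_succ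
      have hdist := hl _ (t (n + 1)).2 _ (t n).2
      rw [abs_of_nonneg (sub_nonneg.2 hle)] at hdist
      calc ‖F (γ (t (n + 1))) - F (γ 0)‖
          ≤ ‖F (γ (t (n + 1))) - F (γ (t n))‖ + ‖F (γ (t n)) - F (γ 0)‖ :=
            norm_sub_le_norm_sub_add_norm_sub _ _ _
        _ ≤ L * (C * dist θ θ' * (t (n + 1) - t n)) + L * (C * dist θ θ') * t n := by
            gcongr
            exact hab.trans (by gcongr)
        _ = L * (C * dist θ θ') * (t (n + 1) : ℝ) := by ring
  have := key N
  rw [hN N le_rfl] at this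
  rw [norm_sub_rev, ← h0, ← h1]
  simpa [mul_assoc, h0, h1] using this

/-- Limit of the interior estimate along pairs of interior points. The strict inequality `dist θ θ'
< r` keeps nearby pairs within distance `r`. -/
lemma LocallyLipschitzInside.norm_sub_le_of_continuousOn (hF : LocallyLipschitzInside Θ F L)
    (hL : 0 ≤ L) (hΘ : JoinedByPaths Θ C r) (hcl : Θ ⊆ closure (interior Θ))
    (hc : ContinuousOn F Θ) {θ θ' : Param d} (hθ : θ ∈ Θ) (hθ' : θ' ∈ Θ)
    (hd : dist θ θ' < r) : ‖F θ - F θ'‖ ≤ L * C * dist θ θ' := by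
  set S := interior Θ ×ˢ interior Θ with hS
  have hne : (𝓝[S] (θ, θ')).NeBot := by
    rw [← mem_closure_iff_nhdsWithin_neBot, hS, closure_prod_eq]
    exact ⟨hcl hθ, hcl hθ'⟩
  have hS1 : Tendsto (fun p : Param d × Param d => p.1) (𝓝[S] (θ, θ')) (𝓝[Θ] θ) :=
    tendsto_nhdsWithin_iff.2 ⟨continuous_fst.continuousWithinAt,
      eventually_mem_nhdsWithin.mono fun p hp => interior_subset hp.1⟩
  have hS2 : Tendsto (fun p : Param d × Param d => p.2) (𝓝[S] (θ, θ')) (𝓝[Θ] θ') :=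
    tendsto_nhdsWithin_iff.2 ⟨continuous_snd.continuousWithinAt,
      eventually_mem_nhdsWithin.mono fun p hp => interior_subset hp.2⟩
  have hdist : Tendsto (fun p : Param d × Param d => dist p.1 p.2) (𝓝[S] (θ, θ'))
      (𝓝 (dist θ θ')) := (continuous_dist.tendsto (θ, θ')).mono_left nhdsWithin_le_nhds
  refine le_of_tendsto_of_tendsto (((hc θ hθ).tendsto.comp hS1).sub
    ((hc θ' hθ').tendsto.comp hS2)).norm (hdist.const_mul (L * C)) ?_
  filter_upwards [hdist.eventually_lt_const hd, eventually_mem_nhdsWithin] with p hp hpS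
  exact hF.norm_sub_le hL hΘ hpS.1 hpS.2 hp.le

lemma norm_le_sum_norm_apply_single {E : Type*} [NormedAddCommGroup E] [NormedSpace ℝ E]
    (A : Param d →L[ℝ] E) :
    ‖A‖ ≤ ∑ i, ‖A (EuclideanSpace.single i (1 : ℝ))‖ := by
  refine A.opNorm_le_bound (by positivity) fun v => ?_
  have hv : v = ∑ i, v i • EuclideanSpace.single i (1 : ℝ) := by
    ext j
    simp [Finset.sum_apply, Pi.single_apply]
  conv_lhs => rw [hv, map_sum]
  rw [Finset.sum_mul]
  refine (norm_sum_le _ _).trans (Finset.sum_le_sum fun i _ => ?_)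
  rw [map_smul, norm_smul, mul_comm]
  gcongr
  exact PiLp.norm_apply_le v i

lemma LocallyLipschitzInside.of_fderiv [NormedSpace ℝ E]
    (hF : ∀ θ ∈ interior Θ, DifferentiableAt ℝ F θ)
    (hL : ∀ θ ∈ interior Θ, ‖fderiv ℝ F θ‖ ≤ L) : LocallyLipschitzInside Θ F L := by
  intro a ha
  obtain ⟨δ, hδ, hsub⟩ := Metric.isOpen_iff.1 isOpen_interior a ha
  refine ⟨δ, hδ, fun x hx y hy => ?_⟩
  rw [dist_eq_norm]
  exact (convex_ball a δ).norm_image_sub_le_of_norm_fderiv_le (fun z hz => hF z (hsub hz))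
    (fun z hz => hL z (hsub hz)) hy hx

end Paths

/-! ### Pointwise bounds from integral bounds -/

/-- A function whose integral against smooth test functions is dominated by that of `B` is
dominated by `B` almost everywhere. -/
lemma ae_norm_le_of_norm_integral_smul_le {A : ℝ → ℂ} {B : ℝ → ℝ} (hA : LocallyIntegrable A)
    (hB : LocallyIntegrable B)
    (h : ∀ ψ : ℝ → ℝ, ContDiff ℝ ∞ ψ → HasCompactSupport ψ → (∀ t, 0 ≤ ψ t) →
      ‖∫ t, (ψ t : ℂ) * A t‖ ≤ ∫ t, ψ t * B t) : ∀ᵐ t, ‖A t‖ ≤ B t := by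
  -- Bumps shrinking to a point with fixed ratio of outer to inner radius, as Lebesgue
  -- differentiation requires. Convolution at `t` is integration against the test function `s ↦ φ n
  -- (t - s)`, to which the hypothesis applies.
  let φ : ℕ → ContDiffBump (0 : ℝ) := fun n =>
    ⟨1 / (n + 1 : ℝ), 2 * (1 / (n + 1 : ℝ)), by positivity, by
      have : (0 : ℝ) < 1 / (n + 1 : ℝ) := by positivity
      linarith⟩
  have hφ : Tendsto (fun n => (φ n).rOut) atTop (𝓝 0) := by
    have := (tendsto_one_div_add_atTop_nhds_zero_nat (𝕜 := ℝ)).const_mul 2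
    rwa [mul_zero] at this
  have hK : ∀ᶠ n in atTop, (φ n).rOut ≤ 2 * (φ n).rIn := Eventually.of_forall fun n => le_rfl
  filter_upwards [ContDiffBump.ae_convolution_tendsto_right_of_locallyIntegrable hφ hK hA,
    ContDiffBump.ae_convolution_tendsto_right_of_locallyIntegrable hφ hK hB] with t hAt hBt
  refine le_of_tendsto_of_tendsto hAt.norm hBt (Eventually.of_forall fun n => ?_)
  have hψ : ContDiff ℝ ∞ fun s => (φ n).normed volume (t - s) :=
    (φ n).contDiff_normed.comp (contDiff_const.sub contDiff_id)
  have hc : HasCompactSupport fun s => (φ n).normed volume (t - s) :=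
    (φ n).hasCompactSupport_normed.comp_homeomorph (Homeomorph.subLeft t)
  have := h _ hψ hc fun s => (φ n).nonneg_normed _
  simpa [convolution_eq_swap] using this

end ErrorsInVariablesAR
namespace ErrorsInVariablesAR

open scoped FourierTransform ContDiff

/-! ### Lipschitz continuity of the deconvolution kernels in the parameter -/

section DeconvLipschitz

variable {d : ℕ} {Θ : Set (Param d)} {C r : ℝ} {h : Param d → ℝ → ℝ} {w fε : ℝ → ℝ}

lemma dRegr_eq_fderiv (hD : ∀ x, ContDiffOn ℝ 1 (fun θ => h θ x) (interior Θ)) {θ : Param d}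
    (hθ : θ ∈ interior Θ) (i : Fin d) (x : ℝ) :
    dRegr h i θ x = fderiv ℝ (fun η => h η x) θ (EuclideanSpace.single i (1 : ℝ)) :=
  ((((hD x).differentiableOn one_ne_zero) θ hθ).differentiableAt
    (isOpen_interior.mem_nhds hθ)).lineDeriv_eq_fderiv

lemma continuousOn_dRegr (hD : ∀ x, ContDiffOn ℝ 1 (fun θ => h θ x) (interior Θ)) (i : Fin d)
    (x : ℝ) : ContinuousOn (fun θ => dRegr h i θ x) (interior Θ) :=
  (((hD x).continuousOn_fderiv_of_isOpen isOpen_interior le_rfl).clm_apply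
    continuousOn_const).congr fun _ hθ => dRegr_eq_fderiv hD hθ i x

/-- Bounds on the Fourier transforms of a family of functions that hold uniformly in the parameter
carry over to the functions, if these are continuous in the parameter. -/
lemma ae_forall_abs_le {u : Param d → ℝ → ℝ} {B : ℝ → ℝ}
    (hu : ∀ x, ContinuousOn (fun θ => u θ x) (interior Θ))
    (hI : ∀ θ ∈ interior Θ, Integrable (u θ)) (hB : Integrable B)
    (hbound : ∀ θ ∈ interior Θ, ∀ᵐ t, ‖fourierStar (u θ) t‖ ≤ B t) :
    ∀ᵐ x, ∀ θ ∈ interior Θ, |u θ x| ≤ 1 / (2 * Real.pi) * ∫ t, B t := by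
  -- For each $\theta$ the exceptional null set may differ; a countable dense set of parameters
  -- yields a common one, and continuity in $\theta$ covers the rest.
  have h1 : ∀ᵐ x, ∀ n : ℕ, TopologicalSpace.denseSeq (Param d) n ∈ interior Θ →
      |u (TopologicalSpace.denseSeq (Param d) n) x| ≤ 1 / (2 * Real.pi) * ∫ t, B t := by
    refine ae_all_iff.2 fun n => ?_
    by_cases hn : TopologicalSpace.denseSeq (Param d) n ∈ interior Θ
    · have hF : Integrable (fourierStar (u (TopologicalSpace.denseSeq (Param d) n))) :=
        hB.mono' (continuous_fourierStar (hI _ hn)).aestronglyMeasurable (hbound _ hn)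
      filter_upwards [abs_le_integral_norm_fourierStar_ae (hI _ hn) hF] with x hx _
      refine hx.trans ?_
      have := integral_mono_ae hF.norm hB (hbound _ hn)
      gcongr
    · exact ae_of_all _ fun x h => absurd h hn
  filter_upwards [h1] with x hx θ hθ
  have hcl := (TopologicalSpace.denseRange_denseSeq (Param d)).open_subset_closure_inter
    isOpen_interior hθ
  rw [mem_closure_iff_nhdsWithin_neBot] at hcl
  have ht : Tendsto (fun η => |u η x|)
      (𝓝[interior Θ ∩ range (TopologicalSpace.denseSeq (Param d))] θ) (𝓝 |u θ x|) :=
    ((hu x θ hθ).tendsto.mono_left (nhdsWithin_mono _ inter_subset_left)).abs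
  refine le_of_tendsto ht ?_
  filter_upwards [eventually_mem_nhdsWithin] with η hη
  obtain ⟨n, rfl⟩ := hη.2
  exact hx n hη.1

/-- Pairing of a test function with the Fourier transforms of the functions `w h_θ`. -/
noncomputable def pairing (h : Param d → ℝ → ℝ) (w : ℝ → ℝ) (ψ : ℝ → ℝ) (θ : Param d) : ℂ :=
  ∫ x, fourierStar ψ x * ((w x * h θ x : ℝ) : ℂ)

/-- Dominated convergence: near $\theta$ the integrand is bounded by its modulus at $\theta$ plus
$M|\psi^*|$. Integrability of $\psi^*$ makes a merely bounded increment of $wh_\theta$ sufficient.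
-/
lemma continuousOn_pairing {ψ : ℝ → ℝ} {M : ℝ} (hψ : Integrable ψ)
    (hψ' : Integrable (fourierStar ψ)) (hr : 0 < r)
    (hI : ∀ θ ∈ Θ, Integrable (fun x => w x * h θ x))
    (hC : ∀ x, ContinuousOn (fun θ => h θ x) Θ)
    (hM : ∀ᵐ x, ∀ θ ∈ Θ, ∀ θ' ∈ Θ, dist θ θ' < r → |w x * h θ x - w x * h θ' x| ≤ M) :
    ContinuousOn (pairing h w ψ) Θ := by
  intro θ hθ
  have hb : Integrable (fun x => ‖fourierStar ψ x * ((w x * h θ x : ℝ) : ℂ)‖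
      + ‖fourierStar ψ x‖ * M) := by
    refine Integrable.add (Integrable.norm ?_) (hψ'.norm.mul_const M)
    exact (hI θ hθ).ofReal.bdd_mul (continuous_fourierStar hψ).aestronglyMeasurable
      (ae_of_all _ fun x => norm_fourierStar_le ψ x)
  refine continuousWithinAt_of_dominated (bound := fun x =>
    ‖fourierStar ψ x * ((w x * h θ x : ℝ) : ℂ)‖ + ‖fourierStar ψ x‖ * M) ?_ ?_ hb ?_
  · filter_upwards [eventually_mem_nhdsWithin] with η hη
    exact (continuous_fourierStar hψ).aestronglyMeasurable.mul
      (hI η hη).ofReal.aestronglyMeasurable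
  · filter_upwards [eventually_mem_nhdsWithin,
      mem_nhdsWithin_of_mem_nhds (Metric.ball_mem_nhds θ hr)] with η hη hηr
    filter_upwards [hM] with x hx
    have h1 := hx η hη θ hθ hηr
    rw [norm_mul, norm_mul, ← mul_add, Complex.norm_real, Complex.norm_real]
    gcongr
    rw [Real.norm_eq_abs, Real.norm_eq_abs]
    have := abs_sub_abs_le_abs_sub (w x * h η x) (w x * h θ x)
    linarith
  · refine ae_of_all _ fun x => ?_
    exact continuousWithinAt_const.mul (Complex.continuous_ofReal.continuousAt.comp_continuousWithinAt
      (continuousWithinAt_const.mul (hC x θ hθ)))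

/-- The derivative is taken on the space side, where $|\psi^*|$ times a constant dominates it, and
estimated on the frequency side, where the multiplication formula turns it into
$\int\psi\,(\partial_i h_\theta\,w)^*$, bounded by $\int\psi B_i$. The mean value inequality on a
segment finishes. -/
lemma locallyLipschitzInside_pairing {ψ : ℝ → ℝ} {M : ℝ} {B : Fin d → ℝ → ℝ} (hψ : Integrable ψ)
    (hψ0 : ∀ t, 0 ≤ ψ t) (hψ' : Integrable (fourierStar ψ))
    (hψB : ∀ i, Integrable (fun t => ψ t * B i t))
    (hI : ∀ θ ∈ interior Θ, Integrable (fun x => w x * h θ x))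
    (hD : ∀ x, ContDiffOn ℝ 1 (fun θ => h θ x) (interior Θ))
    (hdI : ∀ θ ∈ interior Θ, ∀ i, Integrable (fun x => dRegr h i θ x * w x))
    (hB : ∀ θ ∈ interior Θ, ∀ i, ∀ᵐ t, ‖fourierStar (fun x => dRegr h i θ x * w x) t‖ ≤ B i t)
    (hM : ∀ i, ∀ᵐ x, ∀ θ ∈ interior Θ, |dRegr h i θ x * w x| ≤ M) :
    LocallyLipschitzInside Θ (pairing h w ψ) (∑ i, ∫ t, ψ t * B i t) := by
  intro a ha
  obtain ⟨δ, hδ, hsub⟩ := Metric.isOpen_iff.1 isOpen_interior a ha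
  refine ⟨δ, hδ, fun y hy x hx => ?_⟩
  set v := y - x with hv
  set U : Set ℝ := (fun s : ℝ => x + s • v) ⁻¹' Metric.ball a δ with hU
  have hUo : IsOpen U := Metric.isOpen_ball.preimage (by fun_prop)
  have hUI : ∀ s ∈ U, x + s • v ∈ interior Θ := fun s hs => hsub hs
  have hIcc : Icc (0 : ℝ) 1 ⊆ U := fun s hs =>
    (convex_ball a δ).add_smul_sub_mem hx hy hs
  have hdir : ∀ θ ∈ interior Θ, ∀ z, fderiv ℝ (fun η => h η z) θ v = ∑ i, v i * dRegr h i θ z := by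
    intro θ hθ z
    have hvs : v = ∑ i, v i • EuclideanSpace.single i (1 : ℝ) := by
      ext j
      simp [Finset.sum_apply, Pi.single_apply]
    conv_lhs => rw [hvs, map_sum]
    simp only [map_smul, smul_eq_mul, dRegr_eq_fderiv hD hθ]
  set J' : ℝ → ℂ := fun s => ∫ z, fourierStar ψ z *
    ((∑ i, v i * (dRegr h i (x + s • v) z * w z) : ℝ) : ℂ) with hJ'
  have hder : ∀ s ∈ U, HasDerivAt (fun s : ℝ => pairing h w ψ (x + s • v)) (J' s) s := by
    intro s hs
    refine (hasDerivAt_integral_of_dominated_loc_of_deriv_le (μ := volume)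
      (F := fun s z => fourierStar ψ z * ((w z * h (x + s • v) z : ℝ) : ℂ))
      (F' := fun s z => fourierStar ψ z * ((∑ i, v i * (dRegr h i (x + s • v) z * w z) : ℝ) : ℂ))
      (bound := fun z => ‖fourierStar ψ z‖ * ∑ i, |v i| * M)
      (hUo.mem_nhds hs) ?_ ?_ ?_ ?_ ?_ ?_).2
    · filter_upwards [hUo.mem_nhds hs] with s hs
      exact (continuous_fourierStar hψ).aestronglyMeasurable.mul
        (hI _ (hUI s hs)).ofReal.aestronglyMeasurable
    · exact (hI _ (hUI s hs)).ofReal.bdd_mul (continuous_fourierStar hψ).aestronglyMeasurable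
        (ae_of_all _ fun x => norm_fourierStar_le ψ x)
    · refine (continuous_fourierStar hψ).aestronglyMeasurable.mul ?_
      have hsum : Integrable (fun z => ∑ i, v i * (dRegr h i (x + s • v) z * w z)) :=
        integrable_finsetSum _ fun i _ => (hdI _ (hUI s hs) i).const_mul (v i)
      exact hsum.ofReal.aestronglyMeasurable
    · filter_upwards [ae_all_iff.2 hM] with z hz s hs
      rw [norm_mul, Complex.norm_real]
      gcongr
      refine (norm_sum_le _ _).trans (Finset.sum_le_sum fun i _ => ?_)
      rw [norm_mul, Real.norm_eq_abs, Real.norm_eq_abs]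
      gcongr
      exact hz i _ (hUI s hs)
    · exact hψ'.norm.mul_const _
    · refine ae_of_all _ fun z s hs => ?_
      have h1 : HasFDerivAt (fun η => h η z) (fderiv ℝ (fun η => h η z) (x + s • v)) (x + s • v) :=
        ((((hD z).differentiableOn one_ne_zero) _ (hUI s hs)).differentiableAt
          (isOpen_interior.mem_nhds (hUI s hs))).hasFDerivAt
      have h2 : HasDerivAt (fun s : ℝ => x + s • v) v s := by
        simpa using ((hasDerivAt_id s).smul_const v).const_add x
      have h3 := h1.comp_hasDerivAt s h2
      rw [hdir _ (hUI s hs)] at h3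
      have h4 := ((h3.const_mul (w z)).ofReal_comp).const_mul (fourierStar ψ z)
      refine h4.congr_deriv ?_
      congr 2
      rw [Finset.mul_sum]
      exact Finset.sum_congr rfl fun i _ => by ring
  have hbd : ∀ s ∈ U, ‖J' s‖ ≤ (∑ i, ∫ t, ψ t * B i t) * ‖v‖ := by
    intro s hs
    -- Back to the frequency side, one coordinate of `v` at a time.
    have e1 : J' s = ∑ i, (v i : ℂ) * ∫ t, (ψ t : ℂ) *
        fourierStar (fun z => dRegr h i (x + s • v) z * w z) t := by
      have e2 : ∀ i, ∫ t, (ψ t : ℂ) * fourierStar (fun z => dRegr h i (x + s • v) z * w z) t =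
          ∫ z, fourierStar ψ z * ((dRegr h i (x + s • v) z * w z : ℝ) : ℂ) := fun i =>
        integral_mul_fourierStar (hdI _ (hUI s hs) i) hψ
      simp only [e2, ← integral_const_mul]
      rw [← integral_finsetSum]
      · refine integral_congr_ae (ae_of_all _ fun z => ?_)
        simp only
        push_cast
        rw [Finset.mul_sum]
        exact Finset.sum_congr rfl fun i _ => by ring
      · intro i _
        exact ((hdI _ (hUI s hs) i).ofReal.bdd_mul
          (continuous_fourierStar hψ).aestronglyMeasurable
          (ae_of_all _ fun x => norm_fourierStar_le ψ x)).const_mul _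
    rw [e1, Finset.sum_mul]
    refine (norm_sum_le _ _).trans (Finset.sum_le_sum fun i _ => ?_)
    rw [norm_mul, Complex.norm_real, mul_comm]
    have h0 : ‖∫ t, (ψ t : ℂ) * fourierStar (fun z => dRegr h i (x + s • v) z * w z) t‖ ≤
        ∫ t, ψ t * B i t := by
      refine norm_integral_le_of_norm_le (hψB i) ?_
      filter_upwards [hB _ (hUI s hs) i] with t ht
      rw [norm_mul, Complex.norm_real, Real.norm_of_nonneg (hψ0 t)]
      exact mul_le_mul_of_nonneg_left ht (hψ0 t)
    exact mul_le_mul h0 (PiLp.norm_apply_le v i) (norm_nonneg _) ((norm_nonneg _).trans h0)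
  have hmv := (convex_Icc (0 : ℝ) 1).norm_image_sub_le_of_norm_hasDerivWithin_le
    (fun s hs => (hder s (hIcc hs)).hasDerivWithinAt) (fun s hs => hbd s (hIcc hs))
    (left_mem_Icc.2 zero_le_one) (right_mem_Icc.2 zero_le_one)
  simpa [hv, dist_eq_norm] using hmv

/-- No bound on $\partial_i h_\theta\,w$ in $L^1(dx)$ uniform in $\theta$ is assumed, so
$(wh_\theta)^*(t)$ cannot be differentiated directly at fixed $t$. Instead its integral against an
arbitrary test function $\psi\ge0$ is shown to be Lipschitz with constant $C\sum_i\int\psi B_i$.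
Localizing $\psi$ gives a bound for almost every $t$, which is then divided by $|f_\varepsilon^*|$
and integrated. -/
theorem exists_lipschitz_deconv {θ₀ : Param d} (hΘ : IsParamSet Θ θ₀) (hfε : Integrable fε)
    (hne : ∀ t, fourierStar fε t ≠ 0)
    (hC : ∀ x, ContinuousOn (fun θ => h θ x) Θ)
    (hD : ∀ x, ContDiffOn ℝ 1 (fun θ => h θ x) (interior Θ))
    (hI : ∀ θ ∈ Θ, Integrable (fun x => w x * h θ x))
    (hdI : ∀ θ ∈ interior Θ, ∀ i, Integrable (fun x => dRegr h i θ x * w x))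
    (hsup : ∀ i : Fin d, ∫⁻ t : ℝ, (⨆ θ ∈ interior Θ,
      ‖fourierStar (fun x => dRegr h i θ x * w x) t / fourierStar fε t‖ₑ) < ⊤) :
    ∃ L ρ : ℝ, 0 ≤ L ∧ 0 < ρ ∧ ∀ θ ∈ Θ, ∀ θ' ∈ Θ, dist θ θ' < ρ →
      ∫ t, ‖fourierStar (fun x => w x * h θ x) t / fourierStar fε t
        - fourierStar (fun x => w x * h θ' x) t / fourierStar fε t‖ ≤ L * dist θ θ' := by
  obtain ⟨C, r, hC0, hr, hpath⟩ := hΘ.joinedByPaths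
  have hcε := continuous_fourierStar hfε
  set g : Fin d → ℝ → ENNReal := fun i t => ⨆ θ ∈ interior Θ,
    ‖fourierStar (fun x => dRegr h i θ x * w x) t / fourierStar fε t‖ₑ with hg
  have hgm : ∀ i, Measurable (g i) := fun i =>
    (lowerSemicontinuous_biSup fun θ hθ => Continuous.lowerSemicontinuous
      ((continuous_fourierStar (hdI θ hθ i)).div hcε hne).enorm).measurable
  have hgfin : ∀ i, ∀ᵐ t, g i t < ⊤ := fun i => ae_lt_top (hgm i) (hsup i).ne
  have hgi : ∀ i, Integrable (fun t => (g i t).toReal) := fun i =>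
    integrable_toReal_of_lintegral_ne_top (hgm i).aemeasurable (hsup i).ne
  -- Multiplying by the bounded function $|f_\varepsilon^*|$ undoes the division and keeps
  -- integrability, so `B i` bounds the transforms themselves.
  set B : Fin d → ℝ → ℝ := fun i t => (g i t).toReal * ‖fourierStar fε t‖ with hBdef
  have hB0 : ∀ i t, 0 ≤ B i t := fun i t => by positivity
  have hBi : ∀ i, Integrable (B i) := fun i =>
    (hgi i).mul_bdd (c := ∫ x, |fε x|) hcε.norm.aestronglyMeasurable
      (ae_of_all _ fun t => by rw [norm_norm]; exact norm_fourierStar_le _ _)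
  have hB : ∀ θ ∈ interior Θ, ∀ i, ∀ᵐ t,
      ‖fourierStar (fun x => dRegr h i θ x * w x) t‖ ≤ B i t := by
    intro θ hθ i
    filter_upwards [hgfin i] with t ht
    have h1 : ‖fourierStar (fun x => dRegr h i θ x * w x) t / fourierStar fε t‖ₑ ≤ g i t :=
      le_iSup₂ (f := fun θ (_ : θ ∈ interior Θ) =>
        ‖fourierStar (fun x => dRegr h i θ x * w x) t / fourierStar fε t‖ₑ) θ hθ
    have h2 := ENNReal.toReal_mono ht.ne h1
    rw [toReal_enorm, norm_div, div_le_iff₀ (norm_pos_iff.2 (hne t))] at h2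
    exact h2
  set M : Fin d → ℝ := fun i => 1 / (2 * Real.pi) * ∫ t, B i t with hMdef
  have hM0 : ∀ i, 0 ≤ M i := fun i =>
    mul_nonneg (by positivity) (integral_nonneg (hB0 i))
  have hM : ∀ i, ∀ᵐ x, ∀ θ ∈ interior Θ, |dRegr h i θ x * w x| ≤ M i := fun i =>
    ae_forall_abs_le (u := fun θ x => dRegr h i θ x * w x)
      (fun x => (continuousOn_dRegr hD i x).mul continuousOn_const)
      (fun θ hθ => hdI θ hθ i) (hBi i) (fun θ hθ => hB θ hθ i)
  -- The sup bound on derivatives, integrated along paths at fixed `x`: this is the local bound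
  -- needed for continuity of `pairing` up to the boundary of `Θ`.
  have hLip : ∀ᵐ x, ∀ θ ∈ Θ, ∀ θ' ∈ Θ, dist θ θ' < r →
      |w x * h θ x - w x * h θ' x| ≤ (∑ i, M i) * C * r := by
    filter_upwards [ae_all_iff.2 hM] with x hx θ hθ θ' hθ' hd
    have hdiff : ∀ θ ∈ interior Θ, DifferentiableAt ℝ (fun η => h η x) θ := fun θ hθ =>
      (((hD x).differentiableOn one_ne_zero) θ hθ).differentiableAt (isOpen_interior.mem_nhds hθ)
    have hloc : LocallyLipschitzInside Θ (fun η => w x * h η x) (∑ i, M i) := by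
      refine LocallyLipschitzInside.of_fderiv (fun θ hθ => (hdiff θ hθ).const_mul _)
        fun θ hθ => (norm_le_sum_norm_apply_single _).trans (Finset.sum_le_sum fun i _ => ?_)
      rw [fderiv_const_mul (hdiff θ hθ), smul_apply, smul_eq_mul,
        ← dRegr_eq_fderiv hD hθ, mul_comm]
      exact hx i θ hθ
    have hs0 : 0 ≤ ∑ i, M i := Finset.sum_nonneg fun i _ => hM0 i
    refine (hloc.norm_sub_le_of_continuousOn hs0 hpath hΘ.subset_closure
      (continuousOn_const.mul (hC x)) hθ hθ' hd).trans ?_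
    gcongr
  have hMs : ∀ i, ∀ᵐ x, ∀ θ ∈ interior Θ, |dRegr h i θ x * w x| ≤ ∑ i, M i := fun i =>
    (hM i).mono fun x hx θ hθ => (hx θ hθ).trans
      (Finset.single_le_sum (fun j _ => hM0 j) (Finset.mem_univ i))
  refine ⟨C * ∑ i, ∫ t, (g i t).toReal, r, by positivity, hr, fun θ hθ θ' hθ' hd => ?_⟩
  have hae : ∀ᵐ t, ‖fourierStar (fun x => w x * h θ x) t - fourierStar (fun x => w x * h θ' x) t‖ ≤
      C * dist θ θ' * ∑ i, B i t := by
    refine ae_norm_le_of_norm_integral_smul_le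
      ((continuous_fourierStar (hI θ hθ)).sub
        (continuous_fourierStar (hI θ' hθ'))).locallyIntegrable
      ((integrable_finsetSum _ fun i _ => hBi i).const_mul _).locallyIntegrable
      fun ψ hψ hψc hψ0 => ?_
    have hψi : Integrable ψ := hψ.continuous.integrable_of_hasCompactSupport hψc
    have hψF := integrable_fourierStar_of_contDiff hψ hψc
    obtain ⟨K, hK⟩ := hψ.continuous.bounded_above_of_compact_support hψc
    have hψB : ∀ i, Integrable (fun t => ψ t * B i t) := fun i =>
      (hBi i).bdd_mul hψ.continuous.aestronglyMeasurable (ae_of_all _ hK)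
    have hJ : ∀ η ∈ Θ, ∫ t, (ψ t : ℂ) * fourierStar (fun x => w x * h η x) t =
        pairing h w ψ η := fun η hη => integral_mul_fourierStar (hI η hη) hψi
    have hψFi : ∀ η ∈ Θ, Integrable fun t => (ψ t : ℂ) * fourierStar (fun x => w x * h η x) t :=
      fun η hη => (hψi.ofReal (𝕜 := ℂ)).mul_bdd (continuous_fourierStar (hI η hη)).aestronglyMeasurable
        (ae_of_all _ fun t => norm_fourierStar_le _ t)
    have hsum0 : 0 ≤ ∑ i, ∫ t, ψ t * B i t :=
      Finset.sum_nonneg fun i _ => integral_nonneg fun t => mul_nonneg (hψ0 t) (hB0 i t)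
    have hfin := (locallyLipschitzInside_pairing hψi hψ0 hψF hψB
      (fun θ hθ => hI θ (interior_subset hθ)) hD hdI hB hMs).norm_sub_le_of_continuousOn hsum0 hpath
      hΘ.subset_closure (continuousOn_pairing hψi hψF hr hI hC hLip) hθ hθ' hd
    rw [← hJ θ hθ, ← hJ θ' hθ', ← integral_sub (hψFi θ hθ) (hψFi θ' hθ')] at hfin
    simp only [mul_sub]
    refine hfin.trans_eq ?_
    rw [← integral_finsetSum _ fun i _ => hψB i, mul_assoc, mul_comm, ← integral_const_mul]
    congr 1 with t
    rw [← Finset.mul_sum]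
    ring
  have hgs : Integrable fun t => C * dist θ θ' * ∑ i, (g i t).toReal :=
    (integrable_finsetSum _ fun i _ => hgi i).const_mul _
  refine (integral_mono_of_nonneg (ae_of_all _ fun t => norm_nonneg _) hgs ?_).trans_eq ?_
  · filter_upwards [hae] with t ht
    rw [← sub_div, norm_div, div_le_iff₀ (norm_pos_iff.2 (hne t)), mul_assoc, Finset.sum_mul]
    exact ht
  · rw [integral_const_mul, integral_finsetSum _ fun i _ => hgi i]
    ring

end DeconvLipschitz

end ErrorsInVariablesAR
namespace ErrorsInVariablesAR

/-! ### The mean ergodic theorem in `L¹` -/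

section MeanErgodic

variable {α : Type*} [MeasurableSpace α] {P : Measure α} {T : α → α} {g : α → ℝ}

lemma memLp_birkhoffSum {p : ENNReal} (hT : MeasurePreserving T P P) (hg : MemLp g p P) (n : ℕ) :
    MemLp (birkhoffSum T g n) p P :=
  memLp_finsetSum _ fun k _ => hg.comp_measurePreserving (hT.iterate k)

lemma memLp_birkhoffAverage {p : ENNReal} (hT : MeasurePreserving T P P) (hg : MemLp g p P)
    (n : ℕ) : MemLp (birkhoffAverage ℝ T g n) p P :=
  (memLp_birkhoffSum hT hg n).const_smul (n : ℝ)⁻¹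

lemma birkhoffAverage_toLp {p : ENNReal} [Fact (1 ≤ p)] (hT : MeasurePreserving T P P)
    (hg : MemLp g p P) (n : ℕ) :
    birkhoffAverage ℝ (Lp.compMeasurePreservingₗᵢ ℝ T hT : Lp ℝ p P → Lp ℝ p P) _root_.id n
      (hg.toLp g) = (memLp_birkhoffAverage hT hg n).toLp _ := by
  have hit : ∀ k : ℕ, (Lp.compMeasurePreservingₗᵢ ℝ T hT : Lp ℝ p P → Lp ℝ p P)^[k] (hg.toLp g) =
      (hg.comp_measurePreserving (hT.iterate k)).toLp _ := fun k =>
    congrFun (Lp.compMeasurePreserving_iterate hT k) (hg.toLp g)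
  have hsum : birkhoffSum (Lp.compMeasurePreservingₗᵢ ℝ T hT : Lp ℝ p P → Lp ℝ p P) _root_.id n
      (hg.toLp g) = (memLp_birkhoffSum hT hg n).toLp _ := by
    induction n with
    | zero =>
      rw [birkhoffSum_zero]
      exact (MemLp.toLp_zero _).symm
    | succ n ih =>
      rw [birkhoffSum_succ, ih, id, hit, ← MemLp.toLp_add]
      congr 1
      ext x
      exact (birkhoffSum_succ T g n x).symm
  rw [birkhoffAverage, hsum]
  rfl

lemma integral_birkhoffAverage (hT : MeasurePreserving T P P) (hg : Integrable g P) {n : ℕ}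
    (hn : n ≠ 0) : ∫ x, birkhoffAverage ℝ T g n x ∂P = ∫ x, g x ∂P := by
  simp only [birkhoffAverage, birkhoffSum, smul_eq_mul]
  have hi : ∀ k ∈ Finset.range n, Integrable (fun x => g (T^[k] x)) P := fun k _ =>
    (hT.iterate k).integrable_comp_of_integrable hg
  rw [integral_const_mul, integral_finsetSum _ hi]
  have h : ∀ k, ∫ x, g (T^[k] x) ∂P = ∫ x, g x ∂P := fun k => by
    have hk := hT.iterate k
    conv_rhs => rw [← hk.map_eq]
    rw [integral_map hk.aemeasurable (by rw [hk.map_eq]; exact hg.aestronglyMeasurable)]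
  have hn' : (n : ℝ) ≠ 0 := Nat.cast_ne_zero.2 hn
  simp only [h, Finset.sum_const, Finset.card_range, nsmul_eq_mul]
  field_simp

variable [IsProbabilityMeasure P]

/-- Von Neumann's theorem: averages of the Koopman isometry converge in $L^2$ to an invariant
function, which ergodicity makes constant. The averages keep the mean of `g`, which identifies the
constant. -/
lemma tendsto_birkhoffAverage_of_memLp_two (hT : Ergodic T P) (hg : MemLp g 2 P) :
    Tendsto (fun n => eLpNorm (birkhoffAverage ℝ T g n - fun _ => ∫ x, g x ∂P) 1 P) atTop
      (𝓝 0) := by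
  set hm := hT.toMeasurePreserving
  obtain ⟨U, hU, hU1⟩ : ∃ U : Lp ℝ 2 P →L[ℝ] Lp ℝ 2 P,
      (U : Lp ℝ 2 P → Lp ℝ 2 P) = Lp.compMeasurePreservingₗᵢ ℝ T hm ∧ ‖U‖ ≤ 1 :=
    ⟨(Lp.compMeasurePreservingₗᵢ ℝ T hm).toContinuousLinearMap, rfl,
      LinearIsometry.norm_toContinuousLinearMap_le _⟩
  obtain ⟨G, hGU, hlim⟩ : ∃ G : Lp ℝ 2 P, U G = G ∧
      Tendsto (birkhoffAverage ℝ U _root_.id · (hg.toLp g)) atTop (𝓝 G) :=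
    ⟨_, ((U.eqLocus (1 : Lp ℝ 2 P →L[ℝ] Lp ℝ 2 P)).orthogonalProjectionOnto (hg.toLp g)).2,
      U.tendsto_birkhoffAverage_orthogonalProjection hU1 (hg.toLp g)⟩
  rw [hU] at hGU hlim
  obtain ⟨c, hc⟩ : ∃ c, (G : α → ℝ) =ᵐ[P] Function.const α c := by
    refine hT.ae_eq_const_of_ae_eq_comp_ae (Lp.aestronglyMeasurable _) ?_
    have h2 := Lp.coeFn_compMeasurePreserving G hm
    have h3 : Lp.compMeasurePreserving T hm G = G := hGU
    rw [h3] at h2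
    exact h2.symm
  have hlim2 : Tendsto (fun n => eLpNorm (birkhoffAverage ℝ T g n - fun _ => c) 2 P) atTop
      (𝓝 0) := by
    rw [Lp.tendsto_Lp_iff_tendsto_eLpNorm'] at hlim
    refine hlim.congr fun n => eLpNorm_congr_ae ?_
    rw [birkhoffAverage_toLp hm hg n]
    exact (MemLp.coeFn_toLp _).sub hc
  have hlim1 : Tendsto (fun n => eLpNorm (birkhoffAverage ℝ T g n - fun _ => c) 1 P) atTop
      (𝓝 0) :=
    tendsto_of_tendsto_of_tendsto_of_le_of_le tendsto_const_nhds hlim2 (fun _ => zero_le)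
      fun n => eLpNorm_le_eLpNorm_of_exponent_le (by norm_num)
        ((memLp_birkhoffAverage hm hg n).aestronglyMeasurable.sub aestronglyMeasurable_const)
  have hgi : Integrable g P := hg.integrable (by norm_num)
  have hint : Tendsto (fun n => ∫ x, birkhoffAverage ℝ T g n x ∂P) atTop (𝓝 (∫ _, c ∂P)) :=
    tendsto_integral_of_L1' _ aestronglyMeasurable_const
      (Eventually.of_forall fun n => (memLp_birkhoffAverage hm hg n).integrable (by norm_num)) hlim1
  have hc' : c = ∫ x, g x ∂P := by
    have h5 : Tendsto (fun n => ∫ x, birkhoffAverage ℝ T g n x ∂P) atTop (𝓝 (∫ x, g x ∂P)) :=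
      tendsto_const_nhds.congr' ((eventually_ne_atTop 0).mono fun n hn =>
        (integral_birkhoffAverage hm hgi hn).symm)
    simpa using tendsto_nhds_unique hint h5
  rwa [hc'] at hlim1

/-- The mean ergodic theorem in `L¹`. -/
theorem tendsto_birkhoffAverage_of_integrable (hT : Ergodic T P) (hg : Integrable g P) :
    Tendsto (fun n => eLpNorm (birkhoffAverage ℝ T g n - fun _ => ∫ x, g x ∂P) 1 P) atTop
      (𝓝 0) := by
  set hm := hT.toMeasurePreserving
  have hconst : ∀ c : ℝ, MemLp (fun _ : α => c) 1 P := fun c => memLp_const c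
  set V : Lp ℝ 1 P →ₗᵢ[ℝ] Lp ℝ 1 P := Lp.compMeasurePreservingₗᵢ ℝ T hm with hV
  set U : Lp ℝ 1 P → Lp ℝ 1 P := ⇑V with hU
  set l : Lp ℝ 1 P → Lp ℝ 1 P := fun G => Lp.const 1 P (∫ x, G x ∂P) with hl
  have hlc : Continuous l := (Lp.constL 1 P ℝ).continuous.comp continuous_integral
  have hiff : ∀ (g : α → ℝ) (hg : MemLp g 1 P),
      Tendsto (birkhoffAverage ℝ U _root_.id · (hg.toLp g)) atTop (𝓝 (l (hg.toLp g))) ↔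
      Tendsto (fun n => eLpNorm (birkhoffAverage ℝ T g n - fun _ => ∫ x, g x ∂P) 1 P) atTop
      (𝓝 0) := by
    intro g hg
    have h1 : l (hg.toLp g) = (hconst (∫ x, g x ∂P)).toLp _ := by
      rw [hl]
      simp only
      rw [integral_congr_ae hg.coeFn_toLp]
      rfl
    have h2 : ∀ n, birkhoffAverage ℝ U _root_.id n (hg.toLp g) =
      (memLp_birkhoffAverage hm hg n).toLp _ := birkhoffAverage_toLp hm hg
    simp only [h1, h2]
    exact Lp.tendsto_Lp_iff_tendsto_eLpNorm'' _ _ _ _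
  -- The Koopman averages on $L^1$ are equicontinuous, so the set of good functions is closed; it
  -- contains the simple functions, which lie in $L^2$ and are dense.
  have hclosed : IsClosed {G | Tendsto (birkhoffAverage ℝ U _root_.id · G) atTop (𝓝 (l G))} :=
    isClosed_setOfPred_tendsto_birkhoffAverage ℝ
      V.lipschitz uniformContinuous_id hlc
  have hdense : Dense {G | Tendsto (birkhoffAverage ℝ U _root_.id · G) atTop (𝓝 (l G))} := by
    refine (Lp.simpleFunc.dense (E := ℝ) (μ := P) (p := 1) ENNReal.one_ne_top).mono fun G hGm => ?_
    have hG := Lp.simpleFunc.toLp_toSimpleFunc (⟨G, hGm⟩ : Lp.simpleFunc ℝ 1 P)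
    set s := Lp.simpleFunc.toSimpleFunc (⟨G, hGm⟩ : Lp.simpleFunc ℝ 1 P)
    have hs := Lp.simpleFunc.memLp (⟨G, hGm⟩ : Lp.simpleFunc ℝ 1 P)
    have hG' : G = hs.toLp s := (congrArg Subtype.val hG).symm
    rw [mem_ofPred_eq, hG', hiff]
    exact tendsto_birkhoffAverage_of_memLp_two hT (s.memLp_of_isFiniteMeasure 2 P)
  have := hclosed.closure_eq ▸ hdense (((memLp_one_iff_integrable).2 hg).toLp g)
  exact (hiff g _).1 this

end MeanErgodic

/-! ### The product of an ergodic system with an i.i.d. sequence -/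

section Product

lemma iterate_shift {F : Type*} (e : ℕ → F) (n : ℕ) :
    (fun (x : ℕ → F) (i : ℕ) => x (i + 1))^[n] e = fun i => e (i + n) := by
  induction n generalizing e with
  | zero => rfl
  | succ n ih =>
    rw [Function.iterate_succ_apply, ih]
    rfl

variable {F : Type*} [MeasurableSpace F] {ν : Measure F} [IsProbabilityMeasure ν]

lemma measurePreserving_shift (n : ℕ) :
    MeasurePreserving (fun (e : ℕ → F) (i : ℕ) => e (i + n)) (Measure.infinitePi fun _ => ν)
      (Measure.infinitePi fun _ => ν) :=
  ⟨by fun_prop, Measure.map_infinitePi_infinitePi_of_inj (P := fun _ : ℕ => ν)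
    (add_left_injective n)⟩

/-- The cylinder depends on coordinates below `n`, the shifted event on coordinates from `n` on. -/
lemma measure_cylinder_inter_shift {s : Finset ℕ} {n : ℕ} (hs : ∀ i ∈ s, i < n)
    {S : Set (∀ _ : s, F)} (hS : MeasurableSet S) {D : Set (ℕ → F)} (hD : MeasurableSet D) :
    Measure.infinitePi (fun _ : ℕ => ν) (cylinder s S ∩ (fun e i => e (i + n)) ⁻¹' D) =
      Measure.infinitePi (fun _ => ν) (cylinder s S) * Measure.infinitePi (fun _ => ν) D := by
  have hind : iIndepFun (fun (i : ℕ) (e : ℕ → F) => e i) (Measure.infinitePi fun _ : ℕ => ν) :=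
    iIndepFun_infinitePi (X := fun _ x => x) (by fun_prop)
  have hle : ∀ i : ℕ, MeasurableSpace.comap (fun e : ℕ → F => e i) inferInstance ≤
      MeasurableSpace.pi := fun i => (measurable_pi_apply i).comap_le
  have h := indep_iSup_of_disjoint hle hind (S := {i | i < n}) (T := {i | n ≤ i})
    (disjoint_left.2 fun i (h1 : i < n) (h2 : n ≤ i) => absurd h1 (not_lt.2 h2))
  have h1 : @MeasurableSet (ℕ → F) (⨆ i ∈ {i | i < n},
      MeasurableSpace.comap (fun e : ℕ → F => e i) inferInstance) (cylinder s S) := by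
    have hm : Measurable[⨆ i ∈ {i | i < n},
        MeasurableSpace.comap (fun e : ℕ → F => e i) inferInstance]
        (s.restrict : (ℕ → F) → _) := by
      refine @measurable_pi_lambda _ _ _ (_) _ _ fun i => ?_
      exact Measurable.of_comap_le (le_iSup₂_of_le (i : ℕ) (hs i i.2) le_rfl)
    exact hm hS
  have h2 : @MeasurableSet (ℕ → F) (⨆ i ∈ {i | n ≤ i},
      MeasurableSpace.comap (fun e : ℕ → F => e i) inferInstance)
      ((fun e i => e (i + n)) ⁻¹' D) := by
    have hm : Measurable[⨆ i ∈ {i | n ≤ i},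
        MeasurableSpace.comap (fun e : ℕ → F => e i) inferInstance]
        (fun (e : ℕ → F) (i : ℕ) => e (i + n)) := by
      refine @measurable_pi_lambda _ _ _ (_) _ _ fun i => ?_
      exact Measurable.of_comap_le (le_iSup₂_of_le (i + n) (Nat.le_add_left n i) le_rfl)
    exact hm hD
  rw [(Indep_iff _ _ _).1 h _ _ h1 h2, (measurePreserving_shift n).measure_preimage
    hD.nullMeasurableSet]

variable {α : Type*} [MeasurableSpace α] {P : Measure α} [IsProbabilityMeasure P] {T : α → α}

/-- The product of an ergodic transformation with the shift of an i.i.d. sequence is ergodic. -/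
theorem ergodic_prodMap_shift (hT : Ergodic T P) :
    Ergodic (Prod.map T (fun (e : ℕ → F) (i : ℕ) => e (i + 1)))
      (P.prod (Measure.infinitePi fun _ => ν)) := by
  set N := Measure.infinitePi fun _ : ℕ => ν with hN
  set σ := fun (e : ℕ → F) (i : ℕ) => e (i + 1) with hσ
  have hm := hT.toMeasurePreserving
  have hmp : MeasurePreserving (Prod.map T σ) (P.prod N) (P.prod N) :=
    hm.prod (measurePreserving_shift 1)
  refine ⟨hmp, ⟨fun s hs hinv => ?_⟩⟩
  have hmem : ∀ n x e, (x, e) ∈ s ↔ (T^[n] x, fun i => e (i + n)) ∈ s := by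
    intro n x e
    have h1 : (Prod.map T σ)^[n] ⁻¹' s = s := by
      induction n with
      | zero => rfl
      | succ n ih => rw [Function.iterate_succ', preimage_comp, hinv, ih]
    conv_lhs => rw [← h1]
    rw [mem_preimage, Prod.map_iterate, Prod.map_apply, iterate_shift]
  -- The measure of the slice over `x`. Invariance of `s` and of the Bernoulli measure makes it
  -- `T`-invariant, hence almost surely a constant `c`, the measure of `s`.
  set p : α → ENNReal := fun x => N (Prod.mk x ⁻¹' s) with hp
  have hpm : Measurable p := measurable_measure_prodMk_left hs
  have hpT : p ∘ T = p := by
    ext x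
    simp only [hp, Function.comp_apply]
    rw [← (measurePreserving_shift (ν := ν) 1).measure_preimage
      (measurable_prodMk_left hs).nullMeasurableSet]
    congr 1
    ext e
    exact (hmem 1 x e).symm
  obtain ⟨c, hc⟩ := hT.toPreErgodic.ae_eq_const_of_ae_eq_comp hpm hpT
  have hQs : (P.prod N) s = c := by
    rw [Measure.prod_apply hs, lintegral_congr_ae hc]
    simp
  have hc_top : c ≠ ⊤ := hQs ▸ measure_ne_top _ _
  have : IsFiniteMeasure (c • P) := Measure.smul_finite P hc_top
  -- That is, `s` is independent of every event. On a rectangle with a cylinder base in coordinates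
  -- below `n`, membership in `s` is read off after `n` steps, so the slice measure factors as the
  -- cylinder's measure times `p (T^[n] x)`, almost surely `c`.
  have hprod : (c • P).prod N = (P.prod N).restrict s := by
    refine Measure.prod_eq_generateFrom (C := {t | MeasurableSet t}) (D := measurableCylinders _)
      MeasurableSpace.generateFrom_measurableSet generateFrom_measurableCylinders
      MeasurableSpace.isPiSystem_measurableSet isPiSystem_measurableCylinders
      (c • P).toFiniteSpanningSetsIn
      ⟨fun _ => univ, fun _ => univ_mem_measurableCylinders _, fun _ => measure_lt_top _ _,
        iUnion_const _⟩ fun B₁ hB₁ B₂ hB₂ => ?_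
    obtain ⟨I, S, hS, rfl⟩ := (mem_measurableCylinders _).1 hB₂
    obtain ⟨n, hn⟩ : ∃ n, ∀ i ∈ I, i < n := ⟨I.sup _root_.id + 1, fun i hi =>
      Nat.lt_succ_of_le (Finset.le_sup (f := _root_.id) hi)⟩
    have hcyl : MeasurableSet (cylinder I S : Set (ℕ → F)) := MeasurableSet.of_mem_measurableCylinders hB₂
    rw [Measure.restrict_apply (hB₁.prod hcyl),
      Measure.prod_apply ((hB₁.prod hcyl).inter hs), Measure.smul_apply, smul_eq_mul]
    have h1 : ∀ x, N (Prod.mk x ⁻¹' (B₁ ×ˢ cylinder I S ∩ s)) =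
        B₁.indicator (fun x => N (cylinder I S) * p (T^[n] x)) x := by
      intro x
      by_cases hx : x ∈ B₁
      · rw [indicator_of_mem hx, ← measure_cylinder_inter_shift hn hS (measurable_prodMk_left hs)]
        congr 1
        ext e
        simp [hx, hmem n x e]
      · rw [indicator_of_notMem hx]
        simp [hx]
    have h2 : ∀ᵐ x ∂P, p (T^[n] x) = c :=
      (hm.iterate n).quasiMeasurePreserving.ae hc
    simp only [h1]
    rw [lintegral_indicator hB₁, lintegral_congr_ae (g := fun _ => N (cylinder I S) * c)
      (ae_restrict_of_ae (h2.mono fun x hx => by simp only [hx])), lintegral_const,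
      Measure.restrict_apply_univ]
    ring
  -- `s` is independent of itself.
  have hcc : c * c = c := by
    have h3 := congrArg (fun m => m s) hprod
    simp only [Measure.prod_smul_left, Measure.smul_apply, hQs, Measure.restrict_apply_self,
      smul_eq_mul] at h3
    exact h3
  rw [eventuallyConst_set']
  by_cases hc0 : c = 0
  · exact Or.inl (ae_eq_empty.2 (hQs.trans hc0))
  · have hc1 : c = 1 := by
      rw [← ENNReal.mul_right_inj hc0 hc_top, hcc, mul_one]
    exact Or.inr (ae_eq_univ.2 ((prob_compl_eq_zero_iff hs).2 (hQs.trans hc1)))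

end Product

end ErrorsInVariablesAR
namespace ErrorsInVariablesAR

/-! ### Deconvolution kernels -/

section Deconv

variable {φ φ' fε : ℝ → ℝ}

/-- The integrand of the deconvolution kernel of `φ`. -/
noncomputable def deconvIntegrand (φ fε : ℝ → ℝ) (z t : ℝ) : ℂ :=
  fourierStar φ t * Complex.exp (-(Complex.I * (t : ℂ) * (z : ℂ))) / fourierStar fε (-t)

/-- The deconvolution kernel `(1/2π) Re ∫ φ*(t) e^{-itz} / fε*(-t) dt`, an unbiased estimate of
`φ(x)` when `z` is an observation of `x` with an error of density `fε`. -/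
noncomputable def deconv (φ fε : ℝ → ℝ) (z : ℝ) : ℝ :=
  1 / (2 * Real.pi) * (∫ t, deconvIntegrand φ fε z t).re

lemma norm_deconvIntegrand (φ fε : ℝ → ℝ) (z t : ℝ) :
    ‖deconvIntegrand φ fε z t‖ = ‖fourierStar φ t / fourierStar fε t‖ := by
  rw [deconvIntegrand, norm_div, norm_mul, norm_exp_neg_I_mul_mul, mul_one, norm_fourierStar_neg,
    norm_div]

lemma continuous_deconvIntegrand (hφ : Integrable φ) (hfε : Integrable fε)
    (hne : ∀ t, fourierStar fε t ≠ 0) :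
    Continuous (fun p : ℝ × ℝ => deconvIntegrand φ fε p.1 p.2) := by
  have h1 := continuous_fourierStar hφ
  have h2 := continuous_fourierStar hfε
  unfold deconvIntegrand
  refine Continuous.div (by fun_prop) (by fun_prop) fun p => hne _

lemma integrable_deconvIntegrand (hφ : Integrable φ) (hfε : Integrable fε)
    (hne : ∀ t, fourierStar fε t ≠ 0)
    (hφε : Integrable (fun t => fourierStar φ t / fourierStar fε t)) (z : ℝ) :
    Integrable (deconvIntegrand φ fε z) :=
  hφε.mono ((continuous_deconvIntegrand hφ hfε hne).comp
    (Continuous.prodMk_right z)).aestronglyMeasurable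
    (ae_of_all _ fun t => (norm_deconvIntegrand φ fε z t).le)

lemma continuous_deconv (hφ : Integrable φ) (hfε : Integrable fε)
    (hne : ∀ t, fourierStar fε t ≠ 0)
    (hφε : Integrable (fun t => fourierStar φ t / fourierStar fε t)) :
    Continuous (deconv φ fε) := by
  have hc := continuous_deconvIntegrand hφ hfε hne
  have hb : ∀ z, ∀ᵐ t, ‖deconvIntegrand φ fε z t‖ ≤ ‖fourierStar φ t / fourierStar fε t‖ :=
    fun z => ae_of_all _ fun t => (norm_deconvIntegrand φ fε z t).le
  have hm : ∀ z, AEStronglyMeasurable (deconvIntegrand φ fε z) volume := fun z =>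
    (hc.comp (Continuous.prodMk_right z)).aestronglyMeasurable
  have hct : ∀ t, Continuous fun z => deconvIntegrand φ fε z t := fun t => by
    have h := hc.comp (by fun_prop : Continuous fun z : ℝ => (z, t))
    simpa only [Function.comp_def] using h
  have h : Continuous fun z => ∫ t, deconvIntegrand φ fε z t :=
    continuous_of_dominated hm hb (Integrable.norm hφε) (ae_of_all _ hct)
  have h' : Continuous fun z => (∫ t, deconvIntegrand φ fε z t).re := Complex.continuous_re.comp h
  unfold deconv
  fun_prop

lemma abs_deconv_le (φ fε : ℝ → ℝ) (z : ℝ) :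
    |deconv φ fε z| ≤ 1 / (2 * Real.pi) * ∫ t, ‖fourierStar φ t / fourierStar fε t‖ := by
  have h0 : 0 ≤ 1 / (2 * Real.pi) := by positivity
  rw [deconv, abs_mul, abs_of_nonneg h0]
  gcongr
  refine (Complex.abs_re_le_norm _).trans ((norm_integral_le_integral_norm _).trans_eq ?_)
  simp only [norm_deconvIntegrand]

lemma abs_deconv_sub_le (hφ : Integrable φ) (hφ' : Integrable φ') (hfε : Integrable fε)
    (hne : ∀ t, fourierStar fε t ≠ 0)
    (hφε : Integrable (fun t => fourierStar φ t / fourierStar fε t))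
    (hφε' : Integrable (fun t => fourierStar φ' t / fourierStar fε t)) (z : ℝ) :
    |deconv φ fε z - deconv φ' fε z| ≤ 1 / (2 * Real.pi) *
      ∫ t, ‖fourierStar φ t / fourierStar fε t - fourierStar φ' t / fourierStar fε t‖ := by
  have h : deconv φ fε z - deconv φ' fε z = deconv (fun x => φ x - φ' x) fε z := by
    rw [deconv, deconv, deconv, ← mul_sub, ← Complex.sub_re,
      ← integral_sub (integrable_deconvIntegrand hφ hfε hne hφε z)
        (integrable_deconvIntegrand hφ' hfε hne hφε' z)]
    congr 3 with t
    rw [deconvIntegrand, deconvIntegrand, deconvIntegrand, fourierStar_sub hφ hφ']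
    ring
  rw [h]
  refine (abs_deconv_le _ _ z).trans_eq ?_
  simp only [fourierStar_sub hφ hφ', sub_div]

/-- The deconvolution kernel is unbiased, up to Fourier inversion. -/
lemma integral_deconv_add {P : Measure ℝ} [IsProbabilityMeasure P] (hφ : Integrable φ)
    (hfε : Integrable fε) (hP : ∀ t : ℝ, ∫ e, Complex.exp (Complex.I * (t : ℂ) * (e : ℂ)) ∂P =
      fourierStar fε t)
    (hne : ∀ t, fourierStar fε t ≠ 0)
    (hφε : Integrable (fun t => fourierStar φ t / fourierStar fε t)) (x : ℝ) :
    ∫ e, deconv φ fε (x + e) ∂P = (fourierInvStar (fourierStar φ) x).re := by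
  have hc := continuous_deconvIntegrand hφ hfε hne
  have hprod : Integrable (Function.uncurry fun e t : ℝ => deconvIntegrand φ fε (x + e) t)
      (P.prod volume) := by
    refine Integrable.mono ((hφε.comp_snd P)) ?_
      (ae_of_all _ fun p => (norm_deconvIntegrand φ fε (x + p.1) p.2).le)
    exact (hc.comp (by fun_prop : Continuous fun p : ℝ × ℝ => (x + p.1, p.2))).aestronglyMeasurable
  have hint : Integrable (fun e => ∫ t, deconvIntegrand φ fε (x + e) t) P := hprod.integral_prod_left
  have hre : ∫ e, (∫ t, deconvIntegrand φ fε (x + e) t).re ∂P =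
      (∫ e, (∫ t, deconvIntegrand φ fε (x + e) t) ∂P).re := integral_re hint
  simp only [deconv]
  rw [integral_const_mul, hre, integral_integral_swap hprod, fourierInvStar, Complex.re_ofReal_mul]
  congr 3 with t
  -- After Fubini the error enters only through $e^{-ite}$, whose mean $f_\varepsilon^*(-t)$ cancels
  -- the denominator.
  have h1 : ∀ e : ℝ, deconvIntegrand φ fε (x + e) t =
      fourierStar φ t * Complex.exp (-(Complex.I * (t : ℂ) * (x : ℂ))) / fourierStar fε (-t) *
        Complex.exp (Complex.I * ((-t : ℝ) : ℂ) * (e : ℂ)) := by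
    intro e
    rw [deconvIntegrand, div_mul_eq_mul_div, mul_assoc (fourierStar φ t), ← Complex.exp_add]
    congr 3
    push_cast
    ring
  simp only [h1]
  rw [integral_const_mul, hP, div_mul_cancel₀ _ (hne _)]

lemma integrable_fourierStar_of_div (hfε : Integrable fε)
    (hne : ∀ t, fourierStar fε t ≠ 0)
    (hφε : Integrable (fun t => fourierStar φ t / fourierStar fε t)) :
    Integrable (fourierStar φ) := by
  refine (hφε.mul_bdd (c := ∫ x, |fε x|) (continuous_fourierStar hfε).aestronglyMeasurable
    (ae_of_all _ fun t => norm_fourierStar_le fε t)).congr (ae_of_all _ fun t => ?_)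
  exact div_mul_cancel₀ _ (hne t)

/-- The criterion in terms of deconvolution kernels. -/
lemma criterion_eq {d : ℕ} {f : Param d → ℝ → ℝ} {w : ℝ → ℝ} (hfε : Integrable fε)
    (hne : ∀ t, fourierStar fε t ≠ 0) (hw : Integrable w)
    (hwε : Integrable (fun t => fourierStar w t / fourierStar fε t)) {θ : Param d}
    (h1 : Integrable (fun x => w x * f θ x)) (h2 : Integrable (fun x => w x * f θ x ^ 2))
    (h1ε : Integrable (fun t => fourierStar (fun x => w x * f θ x) t / fourierStar fε t))
    (h2ε : Integrable (fun t => fourierStar (fun x => w x * f θ x ^ 2) t / fourierStar fε t))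
    (n : ℕ) (z : ℕ → ℝ) :
    criterion f w fε n z θ = 1 / (n : ℝ) * ∑ k ∈ Finset.range n,
        z (k + 1) ^ 2 * deconv w fε (z k) +
      1 / (n : ℝ) * ∑ k ∈ Finset.range n, (-2 * z (k + 1) * deconv (fun x => w x * f θ x) fε (z k) +
        deconv (fun x => w x * f θ x ^ 2) fε (z k)) := by
  have hterm : ∀ a b : ℝ, (∫ t : ℝ, fourierStar (fun x => (a - f θ x) ^ 2 * w x) t *
      Complex.exp (-(Complex.I * (t : ℂ) * (b : ℂ))) / fourierStar fε (-t)).re =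
      2 * Real.pi * (a ^ 2 * deconv w fε b + (-2 * a * deconv (fun x => w x * f θ x) fε b +
        deconv (fun x => w x * f θ x ^ 2) fε b)) := by
    intro a b
    have hF : ∀ t, fourierStar (fun x => (a - f θ x) ^ 2 * w x) t =
        (a ^ 2 : ℝ) * fourierStar w t + ((-2 * a : ℝ) * fourierStar (fun x => w x * f θ x) t +
          fourierStar (fun x => w x * f θ x ^ 2) t) := by
      intro t
      have h12 : Integrable fun x => -2 * a * (w x * f θ x) + w x * f θ x ^ 2 :=
        (h1.const_mul _).add h2
      rw [← fourierStar_const_mul, ← fourierStar_const_mul, ← fourierStar_add (h1.const_mul _) h2,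
        ← fourierStar_add (hw.const_mul _) h12]
      congr 1 with x
      ring
    have hI : ∀ t, fourierStar (fun x => (a - f θ x) ^ 2 * w x) t *
        Complex.exp (-(Complex.I * (t : ℂ) * (b : ℂ))) / fourierStar fε (-t) =
        (a ^ 2 : ℝ) * deconvIntegrand w fε b t +
          ((-2 * a : ℝ) * deconvIntegrand (fun x => w x * f θ x) fε b t +
          deconvIntegrand (fun x => w x * f θ x ^ 2) fε b t) := by
      intro t
      rw [hF, deconvIntegrand, deconvIntegrand, deconvIntegrand]
      ring
    have i0 := integrable_deconvIntegrand hw hfε hne hwε b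
    have i1 := integrable_deconvIntegrand h1 hfε hne h1ε b
    have i2 := integrable_deconvIntegrand h2 hfε hne h2ε b
    have i12 : Integrable fun t =>
        ((-2 * a : ℝ) : ℂ) * deconvIntegrand (fun x => w x * f θ x) fε b t +
          deconvIntegrand (fun x => w x * f θ x ^ 2) fε b t := (i1.const_mul _).add i2
    simp only [hI]
    rw [integral_add (i0.const_mul _) i12,
      integral_add (i1.const_mul _) i2, integral_const_mul, integral_const_mul, Complex.add_re,
      Complex.add_re, Complex.re_ofReal_mul, Complex.re_ofReal_mul, deconv, deconv, deconv]
    field_simp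
  -- Reindexing from `1..n` to `0..n-1` turns the pairs `(z (k-1), z k)` into `(z k, z (k+1))`.
  have hsum : ∀ g : ℕ → ℝ, ∑ k ∈ Finset.Icc 1 n, g k = ∑ k ∈ Finset.range n, g (k + 1) := by
    intro g
    rw [Finset.range_eq_Ico, Finset.sum_Ico_add' g 0 n 1]
    rfl
  rw [criterion, hsum, ← mul_add, ← Finset.sum_add_distrib]
  simp only [hterm, Nat.add_sub_cancel]
  rw [← Finset.mul_sum, ← mul_assoc]
  congr 1
  have := Real.pi_ne_zero
  -- For `n = 0` both prefactors are zero by the convention on division.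
  rcases eq_or_ne (n : ℝ) 0 with h | h
  · simp [h]
  · field_simp

end Deconv

end ErrorsInVariablesAR
namespace ErrorsInVariablesAR

/-! ### Consequences of the model -/

section Model

variable {Ω : Type*} [MeasurableSpace Ω] {μ : Measure Ω}

/-- Regrouping: the joint law of the triple is a product of three measures, and products are
associative. -/
lemma indepFun_prodMk_of_indepFun [IsProbabilityMeasure μ] {α β γ : Type*} [MeasurableSpace α] [MeasurableSpace β]
    [MeasurableSpace γ] {a : Ω → α} {b : Ω → β} {c : Ω → γ} (ha : Measurable a)
    (hb : Measurable b) (hc : Measurable c) (h : IndepFun a (fun ω => (b ω, c ω)) μ)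
    (hbc : IndepFun b c μ) : IndepFun (fun ω => (a ω, b ω)) c μ := by
  have hab : IndepFun a b μ := h.comp measurable_id measurable_fst
  have := Measure.isProbabilityMeasure_map (μ := μ) ha.aemeasurable
  have := Measure.isProbabilityMeasure_map (μ := μ) hb.aemeasurable
  have := Measure.isProbabilityMeasure_map (μ := μ) hc.aemeasurable
  rw [indepFun_iff_map_prod_eq_prod_map_map (ha.prodMk hb).aemeasurable hc.aemeasurable,
    (indepFun_iff_map_prod_eq_prod_map_map ha.aemeasurable hb.aemeasurable).1 hab]
  have h1 := (indepFun_iff_map_prod_eq_prod_map_map ha.aemeasurable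
    (hb.prodMk hc).aemeasurable).1 h
  rw [(indepFun_iff_map_prod_eq_prod_map_map hb.aemeasurable hc.aemeasurable).1 hbc] at h1
  rw [← (measurePreserving_prodAssoc (μ.map a) (μ.map b) (μ.map c)).symm.map_eq, ← h1,
    Measure.map_map MeasurableEquiv.prodAssoc.symm.measurable (ha.prodMk (hb.prodMk hc))]
  rfl

variable {d : ℕ} {f : Param d → ℝ → ℝ} {θ₀ : Param d} {fε : ℝ → ℝ} {X ξ ε Z : ℕ → Ω → ℝ}

/-- The path of the autoregression started from `p.1` with innovations `p.2`. -/
noncomputable def regressionPath (g : ℝ → ℝ) (p : ℝ × (ℕ → ℝ)) : ℕ → ℝ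
  | 0 => p.1
  | n + 1 => g (regressionPath g p n) + p.2 n

lemma measurable_regressionPath {g : ℝ → ℝ} (hg : Measurable g) :
    Measurable (regressionPath g) := by
  refine measurable_pi_lambda _ fun n => ?_
  induction n with
  | zero => exact measurable_fst
  | succ n ih => exact (hg.comp ih).add ((measurable_pi_apply n).comp measurable_snd)

namespace IsModel

lemma ae_eq_regressionPath (hm : IsModel μ f θ₀ fε X ξ ε Z) :
    (fun ω i => X i ω) =ᵐ[μ] fun ω => regressionPath (f θ₀) (X 0 ω, fun i => ξ i ω) := by
  filter_upwards [ae_all_iff.2 hm.regression] with ω hω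
  ext i
  induction i with
  | zero => rfl
  | succ n ih => rw [hω n, ih]; rfl

lemma measurable_X' (hm : IsModel μ f θ₀ fε X ξ ε Z) : Measurable fun ω i => X i ω := measurable_pi_lambda _ hm.measurable_X
lemma measurable_ξ' (hm : IsModel μ f θ₀ fε X ξ ε Z) : Measurable fun ω i => ξ i ω := measurable_pi_lambda _ hm.measurable_ξ
lemma measurable_ε' (hm : IsModel μ f θ₀ fε X ξ ε Z) : Measurable fun ω i => ε i ω := measurable_pi_lambda _ hm.measurable_ε

lemma indepFun_X₀_ε₀ (hm : IsModel μ f θ₀ fε X ξ ε Z) : IndepFun (X 0) (ε 0) μ :=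
  hm.indep_X₀.comp measurable_id ((measurable_pi_apply 0).comp measurable_snd)

lemma map_ε (hm : IsModel μ f θ₀ fε X ξ ε Z) : μ.map (fun ω i => ε i ω) = Measure.infinitePi fun _ => μ.map (ε 0) := by
  rw [hm.indep_ε.map_fun_eq_infinitePi_map hm.measurable_ε]
  congr 1 with i : 1
  exact (hm.ident_ε i).map_eq

lemma integral_exp_ε (hm : IsModel μ f θ₀ fε X ξ ε Z) (t : ℝ) :
    ∫ e, Complex.exp (Complex.I * (t : ℂ) * (e : ℂ)) ∂(μ.map (ε 0)) = fourierStar fε t := by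
  rw [hm.density_ε, integral_withDensity_eq_integral_toReal_smul
    hm.measurable_fε.ennreal_ofReal (ae_of_all _ fun _ => ENNReal.ofReal_lt_top)]
  refine integral_congr_ae (ae_of_all _ fun x => ?_)
  simp only [ENNReal.toReal_ofReal (hm.fε_nonneg x), Complex.real_smul, mul_comm]

/-- Stationarity: the shift preserves the law of the chain and carries coordinate `0` to coordinate
`1`. -/
lemma integrable_X₁ (hm : IsModel μ f θ₀ fε X ξ ε Z) : Integrable (X 1) μ := by
  have h := hm.ergodic_X.toMeasurePreserving
  have hX := hm.measurable_X'
  have h0 : Integrable (fun x : ℕ → ℝ => x 0) (μ.map fun ω i => X i ω) :=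
    (integrable_map_measure (measurable_pi_apply _).aestronglyMeasurable hX.aemeasurable).2 hm.integrable_X₀
  have h1 : Integrable (fun x : ℕ → ℝ => x 1) (μ.map fun ω i => X i ω) :=
    h.integrable_comp_of_integrable h0
  exact (integrable_map_measure (measurable_pi_apply _).aestronglyMeasurable hX.aemeasurable).1 h1

variable [IsProbabilityMeasure μ]

/-- The Markov chain and the errors are independent. -/
lemma indepFun_X_ε (hm : IsModel μ f θ₀ fε X ξ ε Z) (hf : Measurable (f θ₀)) :
    IndepFun (fun ω i => X i ω) (fun ω i => ε i ω) μ := by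
  -- The whole chain is almost surely a measurable function of the initial value and the
  -- innovations, which are jointly independent of the errors.
  have h := indepFun_prodMk_of_indepFun (hm.measurable_X 0) hm.measurable_ξ' hm.measurable_ε'
    hm.indep_X₀ hm.indep_ξ_ε
  exact (h.comp (measurable_regressionPath hf) measurable_id).congr
    hm.ae_eq_regressionPath.symm (EventuallyEq.refl _ _)

lemma indepFun_X₀_ε₀_ε₁ (hm : IsModel μ f θ₀ fε X ξ ε Z) : IndepFun (fun ω => (X 0 ω, ε 0 ω)) (ε 1) μ := by
  refine indepFun_prodMk_of_indepFun (hm.measurable_X 0) (hm.measurable_ε 0) (hm.measurable_ε 1)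
    ?_ (hm.indep_ε.indepFun zero_ne_one)
  exact hm.indep_X₀.comp (φ := _root_.id) (ψ := fun p : (ℕ → ℝ) × (ℕ → ℝ) => (p.2 0, p.2 1))
    measurable_id (by fun_prop)

lemma indepFun_X₀_ε₀_ξ₀ (hm : IsModel μ f θ₀ fε X ξ ε Z) : IndepFun (fun ω => (X 0 ω, ε 0 ω)) (ξ 0) μ := by
  refine indepFun_prodMk_of_indepFun (hm.measurable_X 0) (hm.measurable_ε 0) (hm.measurable_ξ 0)
    ?_ ?_
  · exact hm.indep_X₀.comp (φ := _root_.id) (ψ := fun p : (ℕ → ℝ) × (ℕ → ℝ) => (p.2 0, p.1 0))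
      measurable_id (by fun_prop)
  · exact (hm.indep_ξ_ε.comp (measurable_pi_apply 0) (measurable_pi_apply 0)).symm

lemma map_X_ε (hm : IsModel μ f θ₀ fε X ξ ε Z) (hf : Measurable (f θ₀)) :
    μ.map (fun ω => ((fun i => X i ω), fun i => ε i ω)) =
      (μ.map fun ω i => X i ω).prod (Measure.infinitePi fun _ => μ.map (ε 0)) := by
  rw [(indepFun_iff_map_prod_eq_prod_map_map hm.measurable_X'.aemeasurable
    hm.measurable_ε'.aemeasurable).1 (hm.indepFun_X_ε hf), hm.map_ε]

/-- The law of large numbers for functions of two consecutive observations. -/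
theorem tendstoInMeasure_average (hm : IsModel μ f θ₀ fε X ξ ε Z) (hf : Measurable (f θ₀)) {u : ℝ × ℝ → ℝ} (hu : Measurable u)
    (hi : Integrable (fun ω => u (Z 0 ω, Z 1 ω)) μ) :
    TendstoInMeasure μ
      (fun (n : ℕ) ω => 1 / (n : ℝ) * ∑ k ∈ Finset.range n, u (Z k ω, Z (k + 1) ω)) atTop
      (fun _ => ∫ ω, u (Z 0 ω, Z 1 ω) ∂μ) := by
  have := Measure.isProbabilityMeasure_map (μ := μ) hm.measurable_X'.aemeasurable
  have := Measure.isProbabilityMeasure_map (μ := μ) (hm.measurable_ε 0).aemeasurable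
  set Y : Ω → (ℕ → ℝ) × (ℕ → ℝ) := fun ω => ((fun i => X i ω), fun i => ε i ω) with hY
  have hYm : Measurable Y := hm.measurable_X'.prodMk hm.measurable_ε'
  have herg := ergodic_prodMap_shift (ν := μ.map (ε 0)) hm.ergodic_X
  rw [← hm.map_X_ε hf] at herg
  set G : (ℕ → ℝ) × (ℕ → ℝ) → ℝ := fun p => u (p.1 0 + p.2 0, p.1 1 + p.2 1) with hG
  have hGm : Measurable G := by fun_prop
  have hZ : ∀ᵐ ω ∂μ, ∀ k, Z k ω = X k ω + ε k ω := ae_all_iff.2 hm.observation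
  have hGY : (fun ω => u (Z 0 ω, Z 1 ω)) =ᵐ[μ] G ∘ Y := by
    filter_upwards [hZ] with ω hω
    simp only [hω, hG, hY, Function.comp_apply]
  have hGi : Integrable G (μ.map Y) :=
    (integrable_map_measure hGm.aestronglyMeasurable hYm.aemeasurable).2 (hi.congr hGY)
  have := Measure.isProbabilityMeasure_map (μ := μ) hYm.aemeasurable
  have hlim := tendsto_birkhoffAverage_of_integrable herg hGi
  have hbm : ∀ n, Measurable (birkhoffAverage ℝ
      (Prod.map (fun (x : ℕ → ℝ) (i : ℕ) => x (i + 1)) (fun (e : ℕ → ℝ) (i : ℕ) => e (i + 1))) G n) := by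
    intro n
    have hsum : Measurable (birkhoffSum (Prod.map (fun (x : ℕ → ℝ) (i : ℕ) => x (i + 1))
        (fun (e : ℕ → ℝ) (i : ℕ) => e (i + 1))) G n) :=
      Finset.measurable_fun_sum _ fun k _ => hGm.comp (herg.measurable.iterate k)
    exact hsum.const_smul (n : ℝ)⁻¹
  have hint : ∫ p, G p ∂(μ.map Y) = ∫ ω, u (Z 0 ω, Z 1 ω) ∂μ := by
    rw [integral_map hYm.aemeasurable hGm.aestronglyMeasurable]
    exact (integral_congr_ae hGY).symm
  rw [hint] at hlim
  have hmeas : TendstoInMeasure μ (fun n ω => birkhoffAverage ℝ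
      (Prod.map (fun (x : ℕ → ℝ) (i : ℕ) => x (i + 1)) (fun (e : ℕ → ℝ) (i : ℕ) => e (i + 1)))
      G n (Y ω)) atTop (fun _ => ∫ ω, u (Z 0 ω, Z 1 ω) ∂μ) := by
    refine tendstoInMeasure_of_tendsto_eLpNorm one_ne_zero
      (fun n => ((hbm n).comp hYm).aestronglyMeasurable) aestronglyMeasurable_const ?_
    refine hlim.congr fun n => ?_
    rw [eLpNorm_map_measure ((hbm n).sub measurable_const).aestronglyMeasurable hYm.aemeasurable]
    rfl
  refine hmeas.congr_left fun n => ?_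
  filter_upwards [hZ] with ω hω
  rw [birkhoffAverage, birkhoffSum, smul_eq_mul, one_div]
  congr 1
  refine Finset.sum_congr rfl fun k _ => ?_
  rw [Prod.map_iterate]
  simp only [hG, hY, Prod.map_apply, iterate_shift, hω, zero_add, add_comm 1 k]

lemma integrable_ε (hm : IsModel μ f θ₀ fε X ξ ε Z) (i : ℕ) : Integrable (ε i) μ :=
  ((hm.ident_ε i).integrable_iff).2 (hm.memLp_ε.integrable (by norm_num))

lemma integrable_ξ₀ (hm : IsModel μ f θ₀ fε X ξ ε Z) : Integrable (ξ 0) μ := hm.memLp_ξ.integrable (by norm_num)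

lemma integrable_Z₁ (hm : IsModel μ f θ₀ fε X ξ ε Z) : Integrable (Z 1) μ :=
  (hm.integrable_X₁.add (hm.integrable_ε 1)).congr ((hm.observation 1).mono fun _ h => h.symm)

lemma integrable_regression (hm : IsModel μ f θ₀ fε X ξ ε Z) : Integrable (fun ω => f θ₀ (X 0 ω)) μ := by
  refine (hm.integrable_X₁.sub hm.integrable_ξ₀).congr ?_
  filter_upwards [hm.regression 0] with ω hω
  simp [hω]

lemma integrable_fε (hm : IsModel μ f θ₀ fε X ξ ε Z) : Integrable fε := by
  refine ⟨hm.measurable_fε.aestronglyMeasurable, ?_⟩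
  have h : ∫⁻ x, ENNReal.ofReal (fε x) = 1 := by
    rw [← setLIntegral_univ, ← withDensity_apply _ MeasurableSet.univ, ← hm.density_ε,
      Measure.map_apply (hm.measurable_ε 0) MeasurableSet.univ]
    simp
  rw [hasFiniteIntegral_iff_ofReal (ae_of_all _ hm.fε_nonneg), h]
  exact ENNReal.one_lt_top

/-- Regression of the next observation on a bounded function of the current one. -/
lemma integral_Z₁_mul (hm : IsModel μ f θ₀ fε X ξ ε Z) {K : ℝ → ℝ} (hK : Measurable K) {M : ℝ} (hM : ∀ z, |K z| ≤ M) :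
    ∫ ω, Z 1 ω * K (Z 0 ω) ∂μ = ∫ ω, f θ₀ (X 0 ω) * K (X 0 ω + ε 0 ω) ∂μ := by
  have hK' : Measurable fun p : ℝ × ℝ => K (p.1 + p.2) := by fun_prop
  have hKm : Measurable fun ω => K (X 0 ω + ε 0 ω) :=
    hK'.comp ((hm.measurable_X 0).prodMk (hm.measurable_ε 0))
  have hb : ∀ᵐ ω ∂μ, ‖K (X 0 ω + ε 0 ω)‖ ≤ M := ae_of_all _ fun ω => hM _
  -- The innovation, and below it the next error, are centered and independent of the current pair
  -- $(X_0,\varepsilon_0)$.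
  have e1 : ∫ ω, K (X 0 ω + ε 0 ω) * ξ 0 ω ∂μ = 0 := by
    have h := (hm.indepFun_X₀_ε₀_ξ₀.comp hK' measurable_id).integral_fun_mul_eq_mul_integral
      hKm.aestronglyMeasurable (hm.measurable_ξ 0).aestronglyMeasurable
    simp only [Function.comp_apply, id, hm.mean_ξ, mul_zero] at h
    exact h
  have e2 : ∫ ω, K (X 0 ω + ε 0 ω) * ε 1 ω ∂μ = 0 := by
    have h := (hm.indepFun_X₀_ε₀_ε₁.comp hK' measurable_id).integral_fun_mul_eq_mul_integral
      hKm.aestronglyMeasurable (hm.measurable_ε 1).aestronglyMeasurable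
    simp only [Function.comp_apply, id, (hm.ident_ε 1).integral_eq, hm.mean_ε, mul_zero] at h
    exact h
  have i0 : Integrable (fun ω => f θ₀ (X 0 ω) * K (X 0 ω + ε 0 ω)) μ :=
    hm.integrable_regression.mul_bdd hKm.aestronglyMeasurable hb
  have i1 : Integrable (fun ω => K (X 0 ω + ε 0 ω) * ξ 0 ω) μ :=
    hm.integrable_ξ₀.bdd_mul hKm.aestronglyMeasurable hb
  have i2 : Integrable (fun ω => K (X 0 ω + ε 0 ω) * ε 1 ω) μ :=
    (hm.integrable_ε 1).bdd_mul hKm.aestronglyMeasurable hb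
  have i01 : Integrable (fun ω => f θ₀ (X 0 ω) * K (X 0 ω + ε 0 ω) +
      K (X 0 ω + ε 0 ω) * ξ 0 ω) μ := i0.add i1
  have h : (fun ω => Z 1 ω * K (Z 0 ω)) =ᵐ[μ] fun ω => f θ₀ (X 0 ω) * K (X 0 ω + ε 0 ω) +
      K (X 0 ω + ε 0 ω) * ξ 0 ω + K (X 0 ω + ε 0 ω) * ε 1 ω := by
    filter_upwards [hm.observation 0, hm.observation 1, hm.regression 0] with ω h0 h1 h2
    rw [h0, h1, h2]
    ring
  rw [integral_congr_ae h, integral_add i01 i2, integral_add i0 i1, e1, e2, add_zero, add_zero]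

variable {φ : ℝ → ℝ}

/-- Inversion must hold $P_X$-almost everywhere. Under absolute continuity the Lebesgue-a.e. version
suffices; otherwise inversion at continuity points is used. -/
lemma ae_fourierInvStar_eq (hm : IsModel μ f θ₀ fε X ξ ε Z) (hne : ∀ t, fourierStar fε t ≠ 0) (hφ : Integrable φ)
    (hφε : Integrable (fun t => fourierStar φ t / fourierStar fε t))
    (hcont : μ.map (X 0) ≪ volume ∨ ∀ᵐ x ∂(μ.map (X 0)), ContinuousAt φ x) :
    ∀ᵐ x ∂(μ.map (X 0)), fourierInvStar (fourierStar φ) x = φ x := by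
  have hF := integrable_fourierStar_of_div hm.integrable_fε hne hφε
  rcases hcont with h | h
  · exact h.ae_le (fourierInvStar_fourierStar_ae hφ hF)
  · exact h.mono fun x hx => fourierInvStar_fourierStar_of_continuousAt hφ hF hx

/-- The deconvolution kernel of `φ` at the observation is an unbiased estimate of `φ` at the
unobserved variable. -/
lemma integral_mul_deconv (hm : IsModel μ f θ₀ fε X ξ ε Z) (hne : ∀ t, fourierStar fε t ≠ 0) (hφ : Integrable φ)
    (hφε : Integrable (fun t => fourierStar φ t / fourierStar fε t))
    (hcont : μ.map (X 0) ≪ volume ∨ ∀ᵐ x ∂(μ.map (X 0)), ContinuousAt φ x) {v : ℝ → ℝ}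
    (hv : Measurable v) (hvi : Integrable (fun ω => v (X 0 ω)) μ) :
    ∫ ω, v (X 0 ω) * deconv φ fε (X 0 ω + ε 0 ω) ∂μ = ∫ ω, v (X 0 ω) * φ (X 0 ω) ∂μ := by
  have hX := hm.measurable_X 0
  have hε := hm.measurable_ε 0
  have := Measure.isProbabilityMeasure_map (μ := μ) hX.aemeasurable
  have := Measure.isProbabilityMeasure_map (μ := μ) hε.aemeasurable
  have hK := (continuous_deconv hφ hm.integrable_fε hne hφε).measurable
  have hlaw := (indepFun_iff_map_prod_eq_prod_map_map hX.aemeasurable hε.aemeasurable).1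
    hm.indepFun_X₀_ε₀
  have hgm : Measurable fun p : ℝ × ℝ => v p.1 * deconv φ fε (p.1 + p.2) := by fun_prop
  have hvi' : Integrable v (μ.map (X 0)) :=
    (integrable_map_measure hv.aestronglyMeasurable hX.aemeasurable).2 hvi
  have hgi : Integrable (fun p : ℝ × ℝ => v p.1 * deconv φ fε (p.1 + p.2))
      ((μ.map (X 0)).prod (μ.map (ε 0))) :=
    (hvi'.comp_fst _).mul_bdd (hK.comp (measurable_fst.add measurable_snd)).aestronglyMeasurable
      (ae_of_all _ fun p => abs_deconv_le φ fε _)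
  have h1 : ∫ ω, v (X 0 ω) * deconv φ fε (X 0 ω + ε 0 ω) ∂μ =
      ∫ p, v p.1 * deconv φ fε (p.1 + p.2) ∂((μ.map (X 0)).prod (μ.map (ε 0))) := by
    rw [← hlaw, integral_map (hX.prodMk hε).aemeasurable hgm.aestronglyMeasurable]
  have hae := hm.ae_fourierInvStar_eq hne hφ hφε hcont
  rw [h1, integral_prod _ hgi]
  simp only [integral_const_mul]
  simp only [integral_deconv_add hφ hm.integrable_fε hm.integral_exp_ε hne hφε]
  have h2 := ae_of_ae_map hX.aemeasurable hae
  rw [integral_map hX.aemeasurable]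
  · refine integral_congr_ae (h2.mono fun ω hω => ?_)
    simp only [hω, Complex.ofReal_re]
  -- The inverse transform is measurable as the partial integral of a jointly measurable kernel.
  · refine hv.aestronglyMeasurable.mul ?_
    refine AEStronglyMeasurable.congr (f := fun x => ∫ e, deconv φ fε (x + e) ∂(μ.map (ε 0)))
      ?_ (ae_of_all _ fun x => integral_deconv_add hφ hm.integrable_fε hm.integral_exp_ε hne hφε x)
    have hd : StronglyMeasurable fun p : ℝ × ℝ => deconv φ fε (p.1 + p.2) :=
      (by fun_prop : Measurable fun p : ℝ × ℝ => deconv φ fε (p.1 + p.2)).stronglyMeasurable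
    exact hd.integral_prod_right.aestronglyMeasurable

/-- $P_X$-almost everywhere $\varphi$ coincides with the inverse transform of an integrable
function, hence is bounded. -/
lemma integrable_mul_weight (hm : IsModel μ f θ₀ fε X ξ ε Z) (hne : ∀ t, fourierStar fε t ≠ 0) (hφ : Integrable φ)
    (hφm : Measurable φ) (hφε : Integrable (fun t => fourierStar φ t / fourierStar fε t))
    (hcont : μ.map (X 0) ≪ volume ∨ ∀ᵐ x ∂(μ.map (X 0)), ContinuousAt φ x) {v : ℝ → ℝ}
    (hvi : Integrable (fun ω => v (X 0 ω)) μ) :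
    Integrable (fun ω => v (X 0 ω) * φ (X 0 ω)) μ := by
  refine hvi.mul_bdd (c := 1 / (2 * Real.pi) * ∫ t, ‖fourierStar φ t‖)
    (hφm.comp (hm.measurable_X 0)).aestronglyMeasurable ?_
  have h := ae_of_ae_map (hm.measurable_X 0).aemeasurable
    (hm.ae_fourierInvStar_eq hne hφ hφε hcont)
  filter_upwards [h] with ω hω
  rw [← Complex.norm_real, ← hω]
  exact norm_fourierInvStar_le _ _

end IsModel

end Model

end ErrorsInVariablesAR

namespace ErrorsInVariablesAR

/-! ### Consistency -/

/-- Consistency of minimizers: pointwise convergence in probability of random criteria that are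
Lipschitz with stochastically bounded constants implies convergence of their minimizers to the
unique minimum point of the limit. -/
theorem tendstoInMeasure_of_isMinOn {Ω E : Type*} [MeasurableSpace Ω] {μ : Measure Ω}
    [PseudoMetricSpace E] {K : Set E} {θ₀ : E} {T : E → ℝ} {Tn : ℕ → E → Ω → ℝ}
    {W : ℕ → Ω → ℝ} {m ρ : ℝ} {θhat : ℕ → Ω → E} (hK : IsCompact K) (hθ₀ : θ₀ ∈ K) (hρ : 0 < ρ)
    (hm : 0 ≤ m)
    (hT : ∀ θ ∈ K, TendstoInMeasure μ (fun n => Tn n θ) atTop (fun _ => T θ))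
    (hW : TendstoInMeasure μ W atTop (fun _ => m))
    (hTn : ∀ n ω, ∀ θ ∈ K, ∀ θ' ∈ K, dist θ θ' < ρ →
      |Tn n θ ω - Tn n θ' ω| ≤ W n ω * dist θ θ')
    (hTc : ContinuousOn T K)
    (hmin : ∀ θ ∈ K, θ ≠ θ₀ → T θ₀ < T θ)
    (hθhat : ∀ n : ℕ, 1 ≤ n → ∀ᵐ ω ∂μ, θhat n ω ∈ K ∧
      ∀ θ ∈ K, Tn n (θhat n ω) ω ≤ Tn n θ ω) :
    TendstoInMeasure μ θhat atTop (fun _ => θ₀) := by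
  rw [tendstoInMeasure_iff_dist]
  intro ε hε
  set A := K ∩ {θ | ε ≤ dist θ θ₀} with hA
  have hAc : IsCompact A := hK.inter_right (isClosed_le continuous_const (by fun_prop))
  -- The gap is split in three: deviation of the criterion at a net point, deviation at `θ₀`, and
  -- oscillation between the minimizer and the net point.
  obtain ⟨η, hη, hgap⟩ : ∃ η > 0, ∀ θ ∈ A, T θ₀ + 3 * η ≤ T θ := by
    rcases A.eq_empty_or_nonempty with h | h
    · exact ⟨1, one_pos, fun θ hθ => by simp [h] at hθ⟩
    · obtain ⟨a, ha, hmina⟩ := hAc.exists_isMinOn h (hTc.mono inter_subset_left)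
      have hne : a ≠ θ₀ := by
        rintro rfl
        have h1 : ε ≤ dist a a := ha.2
        rw [dist_self] at h1
        exact absurd h1 (not_le.2 hε)
      have hlt := hmin a ha.1 hne
      refine ⟨(T a - T θ₀) / 3, by linarith, fun θ hθ => ?_⟩
      have : T a ≤ T θ := hmina hθ
      linarith
  -- On the event `W n ω < m + 1`, the oscillation over a ball of radius `δ` is at most `η`.
  set δ := min ρ (η / (m + 1)) with hδ
  have hδ0 : 0 < δ := lt_min hρ (by positivity)
  obtain ⟨t, htA, htf, ht⟩ := hAc.finite_cover_balls hδ0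
  have hη' : (m + 1) * δ ≤ η := by
    calc (m + 1) * δ ≤ (m + 1) * (η / (m + 1)) := by gcongr; exact min_le_right _ _
      _ = η := by field_simp
  lift t to Finset E using htf
  have hlim : Tendsto (fun n => ∑ a ∈ t, μ {ω | η ≤ dist (Tn n a ω) (T a)} +
      μ {ω | η ≤ dist (Tn n θ₀ ω) (T θ₀)} + μ {ω | 1 ≤ dist (W n ω) m}) atTop (𝓝 0) := by
    have h1 : Tendsto (fun n => ∑ a ∈ t, μ {ω | η ≤ dist (Tn n a ω) (T a)}) atTop
        (𝓝 (∑ a ∈ t, 0)) := tendsto_finsetSum _ fun a ha =>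
      tendstoInMeasure_iff_dist.1 (hT a (htA ha).1) η hη
    have h2 := tendstoInMeasure_iff_dist.1 (hT θ₀ hθ₀) η hη
    have h3 := tendstoInMeasure_iff_dist.1 hW 1 one_pos
    simpa using (h1.add h2).add h3
  refine tendsto_of_tendsto_of_tendsto_of_le_of_le' tendsto_const_nhds hlim
    (Eventually.of_forall fun _ => zero_le) ?_
  filter_upwards [eventually_ge_atTop 1] with n hn
  -- If none of the finitely many bad events occurs, the criterion at a minimizer far from `θ₀`
  -- would exceed its value at `θ₀`.
  have hsub : ∀ᵐ ω ∂μ, ω ∈ {ω | ε ≤ dist (θhat n ω) θ₀} → ω ∈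
      ((⋃ a ∈ t, {ω | η ≤ dist (Tn n a ω) (T a)}) ∪
      {ω | η ≤ dist (Tn n θ₀ ω) (T θ₀)} ∪ {ω | 1 ≤ dist (W n ω) m} : Set Ω) := by
    filter_upwards [hθhat n hn] with ω hω hωε
    by_contra hcon
    simp only [mem_union, mem_iUnion, not_or, not_exists, mem_ofPred_eq, not_le] at hcon
    obtain ⟨⟨h1, h2⟩, h3⟩ := hcon
    obtain ⟨a, hat, hball⟩ := mem_iUnion₂.1 (ht (show θhat n ω ∈ A from ⟨hω.1, hωε⟩))
    have hda : dist (θhat n ω) a < δ := hball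
    have h4 := hTn n ω _ hω.1 a (htA hat).1 (hda.trans_le (min_le_left _ _))
    have h5 := h1 a hat
    have h6 := hgap a (htA hat)
    have h7 := hω.2 θ₀ hθ₀
    rw [Real.dist_eq, abs_lt] at h2 h3 h5
    rw [abs_le] at h4
    have h8 : W n ω * dist (θhat n ω) a ≤ η := by
      refine le_trans ?_ hη'
      exact mul_le_mul (by linarith) hda.le dist_nonneg (by linarith)
    linarith
  refine (measure_mono_ae hsub).trans ((measure_union_le _ _).trans ?_)
  gcongr
  refine (measure_union_le _ _).trans ?_
  gcongr
  exact measure_biUnion_finset_le _ _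

/-! ### Derivative conditions for the family $f_\theta^2$ -/

section Squares

variable {d : ℕ} {Θ : Set (Param d)} {f : Param d → ℝ → ℝ} {w fε : ℝ → ℝ}

lemma dRegr_sq (hD : ∀ x, ContDiffOn ℝ 1 (fun θ => f θ x) (interior Θ)) {θ : Param d}
    (hθ : θ ∈ interior Θ) (i : Fin d) (x : ℝ) :
    dRegr (fun θ x => f θ x ^ 2) i θ x = 2 * (f θ x * dRegr f i θ x) := by
  have hd : DifferentiableAt ℝ (fun η => f η x) θ :=
    (((hD x).differentiableOn one_ne_zero) θ hθ).differentiableAt (isOpen_interior.mem_nhds hθ)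
  rw [dRegr_eq_fderiv (fun x => (hD x).pow 2) hθ, dRegr_eq_fderiv hD hθ, fderiv_fun_pow 2 hd]
  simp
  ring

/-- Since $\partial_i(f_\theta^2)=2f_\theta f^{(1)}_{\theta,i}$, the second supremum condition is,
up to the factor 2, what `exists_lipschitz_deconv` asks of the family $f_\theta^2$. -/
lemma lintegral_iSup_sq_lt_top (hD : ∀ x, ContDiffOn ℝ 1 (fun θ => f θ x) (interior Θ))
    (hw : DerivWeightCondition Θ f w fε) (i : Fin d) :
    ∫⁻ t : ℝ, (⨆ θ ∈ interior Θ, ‖fourierStar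
      (fun x => dRegr (fun θ x => f θ x ^ 2) i θ x * w x) t / fourierStar fε t‖ₑ) < ⊤ := by
  have h : ∀ t : ℝ, (⨆ θ ∈ interior Θ, ‖fourierStar
      (fun x => dRegr (fun θ x => f θ x ^ 2) i θ x * w x) t / fourierStar fε t‖ₑ) =
      2 * ⨆ θ ∈ interior Θ,
        ‖fourierStar (fun x => f θ x * dRegr f i θ x * w x) t / fourierStar fε t‖ₑ := by
    intro t
    simp only [ENNReal.mul_iSup]
    refine iSup_congr fun θ => iSup_congr fun hθ => ?_
    have h1 : (fun x => dRegr (fun θ x => f θ x ^ 2) i θ x * w x) =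
        fun x => 2 * (f θ x * dRegr f i θ x * w x) := by
      ext x
      rw [dRegr_sq hD hθ]
      ring
    rw [h1, fourierStar_const_mul, mul_div_assoc, enorm_mul]
    congr 1
    simp [enorm_eq_nnnorm]
  simp only [h]
  rw [lintegral_const_mul' _ _ (by norm_num)]
  exact ENNReal.mul_lt_top (by norm_num) (hw.sup_fdf i)

end Squares

/-! ### The loss: expectation and dependence on the parameter -/

section Contrast

variable {Ω : Type*} [MeasurableSpace Ω] {μ : Measure Ω} {d : ℕ}
  {Θ : Set (Param d)} {f : Param d → ℝ → ℝ} {θ₀ : Param d} {w fε : ℝ → ℝ}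
  {X ξ ε Z : ℕ → Ω → ℝ}

/-- The part of the criterion that depends on the parameter, for one pair of observations. -/
noncomputable def deconvLoss (f : Param d → ℝ → ℝ) (w fε : ℝ → ℝ) (θ : Param d) (p : ℝ × ℝ) : ℝ :=
  -2 * p.2 * deconv (fun x => w x * f θ x) fε p.1 + deconv (fun x => w x * f θ x ^ 2) fε p.1

lemma measurable_deconvLoss (hw : WeightCondition μ Θ f w fε X) (hfε : Integrable fε)
    (hne : ∀ t, fourierStar fε t ≠ 0) {θ : Param d} (hθ : θ ∈ Θ) :
    Measurable (deconvLoss f w fε θ) := by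
  have h1 := (continuous_deconv (hw.integrable_wf θ hθ) hfε hne (hw.fourier_wf θ hθ)).measurable
  have h2 := (continuous_deconv (hw.integrable_wf_sq θ hθ) hfε hne
    (hw.fourier_wf_sq θ hθ)).measurable
  unfold deconvLoss
  fun_prop

lemma IsModel.aemeasurable_Z (hm : IsModel μ f θ₀ fε X ξ ε Z) (i : ℕ) : AEMeasurable (Z i) μ :=
  ((hm.measurable_X i).add (hm.measurable_ε i)).aemeasurable.congr
    ((hm.observation i).mono fun _ h => h.symm)

lemma IsModel.integrable_Z₁_mul_deconv [IsProbabilityMeasure μ]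
    (hm : IsModel μ f θ₀ fε X ξ ε Z) {φ : ℝ → ℝ}
    (hne : ∀ t, fourierStar fε t ≠ 0) (hφ : Integrable φ)
    (hφε : Integrable (fun t => fourierStar φ t / fourierStar fε t)) :
    Integrable (fun ω => Z 1 ω * deconv φ fε (Z 0 ω)) μ :=
  hm.integrable_Z₁.mul_bdd ((continuous_deconv hφ hm.integrable_fε hne hφε).measurable.comp_aemeasurable
    (hm.aemeasurable_Z 0)).aestronglyMeasurable (ae_of_all _ fun _ => abs_deconv_le φ fε _)

lemma IsModel.integrable_deconv [IsProbabilityMeasure μ]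
    (hm : IsModel μ f θ₀ fε X ξ ε Z) {φ : ℝ → ℝ}
    (hne : ∀ t, fourierStar fε t ≠ 0) (hφ : Integrable φ)
    (hφε : Integrable (fun t => fourierStar φ t / fourierStar fε t)) :
    Integrable (fun ω => deconv φ fε (Z 0 ω)) μ :=
  Integrable.of_bound ((continuous_deconv hφ hm.integrable_fε hne hφε).measurable.comp_aemeasurable
    (hm.aemeasurable_Z 0)).aestronglyMeasurable _ (ae_of_all _ fun _ => abs_deconv_le φ fε _)

lemma IsModel.integrable_deconvLoss [IsProbabilityMeasure μ]
    (hm : IsModel μ f θ₀ fε X ξ ε Z)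
    (hw : WeightCondition μ Θ f w fε X) (hne : ∀ t, fourierStar fε t ≠ 0) {θ : Param d}
    (hθ : θ ∈ Θ) : Integrable (fun ω => deconvLoss f w fε θ (Z 0 ω, Z 1 ω)) μ := by
  have h1 := hm.integrable_Z₁_mul_deconv hne (hw.integrable_wf θ hθ) (hw.fourier_wf θ hθ)
  have h2 := hm.integrable_deconv hne (hw.integrable_wf_sq θ hθ) (hw.fourier_wf_sq θ hθ)
  simp only [deconvLoss, mul_assoc]
  exact (h1.const_mul _).add h2

/-- Regression replaces $Z_1$ by $f_{\theta^0}(X_0)$, then unbiasedness of the kernels replaces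
$Z_0$ by $X_0$. The integrability part allows two such expectations to be subtracted under one
integral. -/
lemma IsModel.integral_deconvLoss [IsProbabilityMeasure μ]
    (hm : IsModel μ f θ₀ fε X ξ ε Z) (hs : Smooth Θ f)
    (hw : WeightCondition μ Θ f w fε X) (hne : ∀ t, fourierStar fε t ≠ 0) (hθ₀ : θ₀ ∈ Θ)
    {θ : Param d} (hθ : θ ∈ Θ) :
    Integrable (fun ω => -2 * (f θ₀ (X 0 ω) * (w (X 0 ω) * f θ (X 0 ω))) +
      w (X 0 ω) * f θ (X 0 ω) ^ 2) μ ∧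
    ∫ ω, deconvLoss f w fε θ (Z 0 ω, Z 1 ω) ∂μ =
      ∫ ω, -2 * (f θ₀ (X 0 ω) * (w (X 0 ω) * f θ (X 0 ω))) +
        w (X 0 ω) * f θ (X 0 ω) ^ 2 ∂μ := by
  have i1 := hw.integrable_wf θ hθ
  have i2 := hw.integrable_wf_sq θ hθ
  have e1 := hw.fourier_wf θ hθ
  have e2 := hw.fourier_wf_sq θ hθ
  have c1 : μ.map (X 0) ≪ volume ∨ ∀ᵐ x ∂(μ.map (X 0)), ContinuousAt (fun y => w y * f θ y) x :=
    hw.continuity.imp_right fun h => (h θ hθ).mono fun x hx => hx.1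
  have c2 : μ.map (X 0) ≪ volume ∨
      ∀ᵐ x ∂(μ.map (X 0)), ContinuousAt (fun y => w y * f θ y ^ 2) x :=
    hw.continuity.imp_right fun h => (h θ hθ).mono fun x hx => hx.2
  have mw := hw.measurable_w
  have mf := hs.measurable_f θ hθ
  have hone : Integrable (fun ω => (fun _ : ℝ => (1 : ℝ)) (X 0 ω)) μ := integrable_const 1
  have j1 := hm.integrable_mul_weight hne i1 (mw.mul mf) e1 c1 hm.integrable_regression
  have j2 := hm.integrable_mul_weight (v := fun _ => 1) hne i2 (mw.mul (mf.pow_const 2)) e2 c2 hone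
  simp only [one_mul] at j2
  refine ⟨(j1.const_mul (-2)).add j2, ?_⟩
  have k1 := hm.integrable_Z₁_mul_deconv hne i1 e1
  have k2 := hm.integrable_deconv hne i2 e2
  have t1 := hm.integral_mul_deconv hne i1 e1 c1 (hs.measurable_f θ₀ hθ₀) hm.integrable_regression
  have t2 := hm.integral_mul_deconv (v := fun _ => 1) hne i2 e2 c2 measurable_const hone
  have t3 := hm.integral_Z₁_mul (continuous_deconv i1 hm.integrable_fε hne e1).measurable
    (abs_deconv_le _ fε)
  have t4 : ∫ ω, deconv (fun x => w x * f θ x ^ 2) fε (Z 0 ω) ∂μ =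
      ∫ ω, deconv (fun x => w x * f θ x ^ 2) fε (X 0 ω + ε 0 ω) ∂μ :=
    integral_congr_ae ((hm.observation 0).mono fun ω hω => by simp only [hω])
  simp only [one_mul] at t2
  simp only [deconvLoss, mul_assoc]
  rw [integral_add (k1.const_mul _) k2, integral_const_mul, t3, t1, t4, t2,
    integral_add (j1.const_mul _) j2, integral_const_mul]

/-- The contrast is the excess of the expected loss. -/
lemma IsModel.contrast_eq [IsProbabilityMeasure μ]
    (hm : IsModel μ f θ₀ fε X ξ ε Z) (hs : Smooth Θ f)
    (hw : WeightCondition μ Θ f w fε X) (hne : ∀ t, fourierStar fε t ≠ 0) (hθ₀ : θ₀ ∈ Θ)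
    {θ : Param d} (hθ : θ ∈ Θ) :
    contrast μ f w X θ₀ θ = ∫ ω, deconvLoss f w fε θ (Z 0 ω, Z 1 ω) ∂μ -
      ∫ ω, deconvLoss f w fε θ₀ (Z 0 ω, Z 1 ω) ∂μ := by
  obtain ⟨i1, h1⟩ := hm.integral_deconvLoss hs hw hne hθ₀ hθ
  obtain ⟨i2, h2⟩ := hm.integral_deconvLoss hs hw hne hθ₀ hθ₀
  rw [h1, h2, ← integral_sub i1 i2, contrast]
  -- Completing the square: the loss at `θ₀` supplies the missing $w f_{\theta^0}^2$.
  congr 1 with ω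
  ring

/-- The loss is Lipschitz in the parameter. -/
lemma exists_lipschitz_deconvLoss (hΘ : IsParamSet Θ θ₀) (hfε : Integrable fε)
    (hne : ∀ t, fourierStar fε t ≠ 0) (hs : Smooth Θ f) (hw : WeightCondition μ Θ f w fε X)
    (hw' : DerivWeightCondition Θ f w fε) :
    ∃ L ρ : ℝ, 0 ≤ L ∧ 0 < ρ ∧ ∀ θ ∈ Θ, ∀ θ' ∈ Θ, dist θ θ' < ρ → ∀ p : ℝ × ℝ,
      |deconvLoss f w fε θ p - deconvLoss f w fε θ' p| ≤ L * (2 * |p.2| + 1) * dist θ θ' := by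
  have hD : ∀ x, ContDiffOn ℝ 1 (fun θ => f θ x) (interior Θ) := fun x =>
    (hs.contDiffOn x).of_le (by norm_num)
  obtain ⟨L₁, ρ₁, hL₁, hρ₁, h₁⟩ := exists_lipschitz_deconv hΘ hfε hne hs.continuousOn hD
    hw.integrable_wf hw'.integrable_df hw'.sup_df
  obtain ⟨L₂, ρ₂, hL₂, hρ₂, h₂⟩ := exists_lipschitz_deconv (h := fun θ x => f θ x ^ 2) hΘ hfε hne
    (fun x => (hs.continuousOn x).pow 2) (fun x => (hD x).pow 2) hw.integrable_wf_sq
    (fun θ hθ i => ((hw'.integrable_fdf θ hθ i).const_mul 2).congr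
      (ae_of_all _ fun x => by simp only [dRegr_sq hD hθ]; ring))
    (lintegral_iSup_sq_lt_top hD hw')
  have hπ : 0 ≤ 1 / (2 * Real.pi) := by positivity
  refine ⟨1 / (2 * Real.pi) * (L₁ + L₂), min ρ₁ ρ₂, by positivity, lt_min hρ₁ hρ₂,
    fun θ hθ θ' hθ' hd p => ?_⟩
  have a1 := abs_deconv_sub_le (hw.integrable_wf θ hθ) (hw.integrable_wf θ' hθ') hfε hne
    (hw.fourier_wf θ hθ) (hw.fourier_wf θ' hθ') p.1
  have a2 := abs_deconv_sub_le (hw.integrable_wf_sq θ hθ) (hw.integrable_wf_sq θ' hθ') hfε hne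
    (hw.fourier_wf_sq θ hθ) (hw.fourier_wf_sq θ' hθ') p.1
  have b1 := a1.trans (mul_le_mul_of_nonneg_left
    (h₁ θ hθ θ' hθ' (hd.trans_le (min_le_left _ _))) hπ)
  have b2 := a2.trans (mul_le_mul_of_nonneg_left
    (h₂ θ hθ θ' hθ' (hd.trans_le (min_le_right _ _))) hπ)
  have hsplit : deconvLoss f w fε θ p - deconvLoss f w fε θ' p =
      -2 * p.2 * (deconv (fun x => w x * f θ x) fε p.1 - deconv (fun x => w x * f θ' x) fε p.1) +
      (deconv (fun x => w x * f θ x ^ 2) fε p.1 - deconv (fun x => w x * f θ' x ^ 2) fε p.1) := by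
    rw [deconvLoss, deconvLoss]
    ring
  have hp : |-2 * p.2| = 2 * |p.2| := by rw [abs_mul]; norm_num
  have hc : 0 ≤ 1 / (2 * Real.pi) * dist θ θ' := by positivity
  have hp0 := abs_nonneg p.2
  calc |deconvLoss f w fε θ p - deconvLoss f w fε θ' p|
      ≤ 2 * |p.2| * (1 / (2 * Real.pi) * (L₁ * dist θ θ')) +
        1 / (2 * Real.pi) * (L₂ * dist θ θ') := by
        rw [hsplit]
        refine (abs_add_le _ _).trans (add_le_add ?_ b2)
        rw [abs_mul, hp]
        exact mul_le_mul_of_nonneg_left b1 (by positivity)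
    _ ≤ 1 / (2 * Real.pi) * (L₁ + L₂) * (2 * |p.2| + 1) * dist θ θ' := by
        -- The cross terms by which the product form of the constant exceeds the actual bound.
        have : 0 ≤ 1 / (2 * Real.pi) * dist θ θ' * (L₂ * (2 * |p.2|) + L₁) := by positivity
        linear_combination this

end Contrast

end ErrorsInVariablesAR

/-! ### Consistency of the estimator -/

theorem mainTheorem1 {Ω : Type*} [MeasurableSpace Ω] (μ : Measure Ω) [IsProbabilityMeasure μ]
    (d : ℕ) (Θ : Set (ErrorsInVariablesAR.Param d)) (θ₀ : ErrorsInVariablesAR.Param d)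
    (f : ErrorsInVariablesAR.Param d → ℝ → ℝ) (w fε : ℝ → ℝ) (X ξ ε Z : ℕ → Ω → ℝ)
    (hΘ : ErrorsInVariablesAR.IsParamSet Θ θ₀)
    (hmodel : ErrorsInVariablesAR.IsModel μ f θ₀ fε X ξ ε Z)
    (hsmooth : ErrorsInVariablesAR.Smooth Θ f)
    (hmoment : ErrorsInVariablesAR.MomentCondition μ Θ f w X Z)
    (hident : ErrorsInVariablesAR.Identifiable μ Θ f w X θ₀)
    (hnoise : ErrorsInVariablesAR.NoiseCondition fε)
    (hweight : ErrorsInVariablesAR.WeightCondition μ Θ f w fε X)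
    (hweight' : ErrorsInVariablesAR.DerivWeightCondition Θ f w fε)
    (θhat : ℕ → Ω → ErrorsInVariablesAR.Param d)
    (hθhat : ∀ n : ℕ, 1 ≤ n → ∀ᵐ ω ∂μ, θhat n ω ∈ Θ ∧
      IsMinOn (ErrorsInVariablesAR.criterion f w fε n (fun k => Z k ω)) Θ (θhat n ω)) :
    TendstoInMeasure μ θhat atTop (fun _ => θ₀) := by

  open ErrorsInVariablesAR in
  have hne := hnoise.fourier_ne_zero
  have hfε := hmodel.integrable_fε
  have hθ₀ : θ₀ ∈ Θ := interior_subset hΘ.mem_interior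
  have hf := hsmooth.measurable_f θ₀ hθ₀
  obtain ⟨L, ρ, hL, hρ, hLip⟩ := exists_lipschitz_deconvLoss hΘ hfε hne hsmooth hweight hweight'
  have hWi : Integrable (fun ω => L * (2 * |Z 1 ω| + 1)) μ :=
    ((hmodel.integrable_Z₁.abs.const_mul 2).add (integrable_const 1)).const_mul L
  have hlossi := fun θ (hθ : θ ∈ Θ) => hmodel.integrable_deconvLoss hweight hne hθ
  set T : Param d → ℝ := fun θ => ∫ ω, deconvLoss f w fε θ (Z 0 ω, Z 1 ω) ∂μ with hT
  set m := ∫ ω, L * (2 * |Z 1 ω| + 1) ∂μ with hmdef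
  have hTLip : ∀ θ ∈ Θ, ∀ θ' ∈ Θ, dist θ θ' < ρ → dist (T θ) (T θ') ≤ m * dist θ θ' := by
    intro θ hθ θ' hθ' hd
    rw [hT, Real.dist_eq, ← integral_sub (hlossi θ hθ) (hlossi θ' hθ'), hmdef,
      ← integral_mul_const, ← Real.norm_eq_abs]
    exact norm_integral_le_of_norm_le (hWi.mul_const _)
      (ae_of_all _ fun ω => hLip θ hθ θ' hθ' hd (Z 0 ω, Z 1 ω))
  have hTc : ContinuousOn T Θ := by
    intro θ hθ
    rw [ContinuousWithinAt, tendsto_iff_dist_tendsto_zero]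
    have h0 : Tendsto (fun η => m * dist η θ) (𝓝[Θ] θ) (𝓝 0) := by
      have : Continuous fun η => m * dist η θ := by fun_prop
      simpa using (this.tendsto θ).mono_left nhdsWithin_le_nhds
    refine squeeze_zero' (Eventually.of_forall fun _ => dist_nonneg) ?_ h0
    filter_upwards [eventually_mem_nhdsWithin,
      mem_nhdsWithin_of_mem_nhds (Metric.ball_mem_nhds θ hρ)] with η hη hηρ
    exact hTLip η hη θ hθ hηρ
  refine tendstoInMeasure_of_isMinOn (T := T) (m := m)
    (Tn := fun n θ ω => 1 / (n : ℝ) * ∑ k ∈ Finset.range n,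
      deconvLoss f w fε θ (Z k ω, Z (k + 1) ω))
    -- Empirical mean of the random Lipschitz constants; it converges to `m` by the same law of
    -- large numbers.
    (W := fun n ω => 1 / (n : ℝ) * ∑ k ∈ Finset.range n, L * (2 * |Z (k + 1) ω| + 1))
    hΘ.isCompact hθ₀ hρ (integral_nonneg fun ω => by positivity) ?_ ?_ ?_ hTc ?_ ?_
  · exact fun θ hθ => hmodel.tendstoInMeasure_average hf
      (measurable_deconvLoss hweight hfε hne hθ) (hlossi θ hθ)
  · exact hmodel.tendstoInMeasure_average (u := fun p => L * (2 * |p.2| + 1)) hf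
      (by fun_prop) hWi
  · intro n ω θ hθ θ' hθ' hd
    rw [← mul_sub, ← Finset.sum_sub_distrib, abs_mul, abs_of_nonneg (by positivity), mul_assoc,
      Finset.sum_mul]
    gcongr
    exact (Finset.abs_sum_le_sum_abs _ _).trans
      (Finset.sum_le_sum fun k _ => hLip θ hθ θ' hθ' hd _)
  · intro θ hθ hθne
    have h1 := hident.unique_min θ hθ hθne
    rw [hmodel.contrast_eq hsmooth hweight hne hθ₀ hθ,
      hmodel.contrast_eq hsmooth hweight hne hθ₀ hθ₀] at h1
    exact (sub_lt_sub_iff_right _).1 h1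
  · intro n hn
    filter_upwards [hθhat n hn] with ω hω
    refine ⟨hω.1, fun θ hθ => ?_⟩
    have hle : criterion f w fε n (fun k => Z k ω) (θhat n ω) ≤
      criterion f w fε n (fun k => Z k ω) θ := hω.2 hθ
    have heq := fun η (hη : η ∈ Θ) => criterion_eq hfε hne hweight.integrable_w hweight.fourier_w
      (hweight.integrable_wf η hη) (hweight.integrable_wf_sq η hη) (hweight.fourier_wf η hη)
      (hweight.fourier_wf_sq η hη) n (fun k => Z k ω)
    -- The summand containing $Z_k^2$ is the same on both sides and cancels path by path, so no
    -- second moment of $X_0$ enters.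
    rw [heq _ hω.1, heq θ hθ] at hle
    exact le_of_add_le_add_left hle
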